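/- **Setting.** Let $n\ge 1$, $d\ge 2$, $T\ge 3$. Let $\mathcal X\subseteq\mathbb R^d$ be closed and convex with $\mathbf 0\in\mathcal X$ and $\|x\|\le D/2$ for all $x\in\mathcal X$. Let $A\in\mathbb R^{n\times d}$ be an unknown deterministic matrix whose rows satisfy $\|a_i\|\le S$, and $b\in\mathbb R^n$ a known vector with $b_{\min}:=\min_i b_i>0$; put $\mathcal Y=\{x\in\mathcal X: Ax\le b\}$ (componentwise). In each round $t=1,\dots,T$ the player plays $x_t$ while, simultaneously, an adversary chooses, knowing only the previous rounds, a convex differentiable cost $f_t:\mathcal X\to\mathbb R$ with $\|\nabla f_t\|\le G$ on $\mathcal X$; the player then observes $f_t$ and $y_t=Ax_t+\epsilon_t$. The noise is conditionally $\rho$-subgaussian ($\rho\ge 0$): for all $t\in[T]$, $i\in[n]$ and $s\in\mathbb R$, $\mathbb E[\epsilon_{t,i}\mid x_1,\epsilon_1,\dots,\epsilon_{t-1},x_t]=0$ and $\mathbb E[e^{s\epsilon_{t,i}}\mid x_1,\epsilon_1,\dots,\epsilon_{t-1},x_t]\le e^{s^2\rho^2/2}$. The regret is $R_T=\sum_{t=1}^Tf_t(x_t)-\min_{x\in\mathcal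 Y}\sum_{t=1}^Tf_t(x)$. **Subroutine.** $\mathcal A$ is a randomized online algorithm for unknown horizon: given an action set $K$ and its past observations it picks a distribution $p_t$ on $K$, from which it samples its action. $C_{\mathcal A}>0$ is a regret constant of $\mathcal A$ up to horizon $T$: for every nonempty closed, possibly nonconvex, $K$ in the ball of radius $D/2$, all convex differentiable costs with gradients bounded by $G$ on $K$ (convexity and differentiability being understood on the convex hull of $K$), and every $m\le T$, $\sum_{t=1}^m\mathbb E_{x\sim p_t}[f_t(x)]-\min_{x\in K}\sum_{t=1}^m f_t(x)\le C_{\mathcal A}\sqrt m$. **OSOCO.** Given $\lambda>0$, $\kappa\ge 0$ and radii $\beta_t$, let $V_t=\lambda I+\sum_{s<t}x_sx_s^\top$ and $S_t=\sum_{s<t}y_sx_s^\top$. The rounds are split into phases; the first phase starts at $t=1$. A phase starting in round $\tau$ uses $\hat A=S_\tau V_\tau^{-1}$ and the pessimistic and optimistic sets $$\mathcal Y^{p}=\{x\in\mathcal X:\hat Ax+\beta_\tau\|x\|_{V_\tau^{-1}}\mathbf 1\le b-\kappa\mathbf 1\},\qquad \mathcal Y^{o}=\{x\in\mathcal X:\hat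 Ax-\beta_\tau\|x\|_{V_\tau^{-1}}\mathbf 1\le b-\kappa\mathbf 1\},$$ where $\|x\|_W=\sqrt{x^\top Wx}$, and starts a new copy of $\mathcal A$ on the action set $\mathcal Y^o$. In each round $t$ of the phase, $\mathcal A$ samples $\tilde x_t$, the player plays $x_t=\gamma_t\tilde x_t$ with $\gamma_t=\max\{\mu\in[0,1]:\mu\tilde x_t\in\mathcal Y^p\}$, and $f_t$ is sent to $\mathcal A$. A new phase starts in round $t$ as soon as $\det V_t>2\det V_\tau$. **Theorem.** Let $\delta\in(0,1/2)$ and run OSOCO with $\lambda=\max(1,D^2)$, $\kappa=0$ and $$\beta_t=\rho\sqrt{d\log\Big(\frac{1+(t-1)D^2/\lambda}{\delta/n}\Big)}+\sqrt\lambda\,S .$$ Then, with probability at least $1-2\delta$, both $Ax_t\le b$ for all $t\in[T]$ and $$R_T\le 4\frac{DG}{b_{\min}}\beta_T\sqrt{3dT\log T}+C_{\mathcal A}\sqrt{4dT\log T}+2DG\sqrt{2T\log(1/\delta)} .$$ -/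

import Mathlib

open MeasureTheory ProbabilityTheory Matrix

noncomputable section

namespace OSOCO

/-- Actions live in `ℝ^d` with the Euclidean norm. -/
abbrev Act (d : ℕ) := EuclideanSpace ℝ (Fin d)

/-! ### Costs -/

/-- `f` is a convex, differentiable cost on the (possibly nonconvex) action set `K` whose gradient
is bounded by `G` on `K`.  Convexity and differentiability are relative to the convex hull of `K`
(which is `K` itself when `K` is convex); if `K` has no interior the gradient is not unique and
it suffices that one of the admissible gradients is bounded. Values of `f` off the hull are
irrelevant. -/
def AdmissibleCost {d : ℕ} (K : Set (Act d)) (G : ℝ) (f : Act d → ℝ) : Prop :=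
  ConvexOn ℝ (convexHull ℝ K) f ∧
    ∀ x ∈ K, ∃ g : Act d, HasGradientWithinAt f g (convexHull ℝ K) x ∧ ‖g‖ ≤ G

/-- The smallest cumulative cost `min_{x ∈ K} F x` of a fixed action in `K`. -/
def bestFixed {d : ℕ} (K : Set (Act d)) (F : Act d → ℝ) : ℝ := sInf (F '' K)

/-! ### The online algorithm used as a subroutine -/

/-- A randomized online algorithm with unknown horizon. Given the action set `K`, the `m` costs
observed so far and the `m` actions sampled so far, it returns the distribution from which it
samples its next action; this distribution is carried by `K`. -/
structure OnlineAlgorithm (d : ℕ) where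
  dist : Set (Act d) → (m : ℕ) → (Fin m → Act d → ℝ) → (Fin m → Act d) → Measure (Act d)
  isProb : ∀ K m f z, IsProbabilityMeasure (dist K m f z)
  carried : ∀ K m f z, K.Nonempty → IsClosed K → dist K m f z Kᶜ = 0

/-- `C > 0` is a regret constant of `alg`, for games that are terminated after at most `T` rounds:
for every closed, not necessarily convex action set `K` within the ball of radius `D / 2`, and
for all admissible costs on `K`, however they are chosen, whenever the game is terminated,
`∑_{s ≤ m} 𝔼_{x ∼ p_s} [f_s x] - min_{x ∈ K} ∑_{s ≤ m} f_s x ≤ C √m`. -/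
def HasRegretConstant {d : ℕ} (alg : OnlineAlgorithm d) (D G : ℝ) (T : ℕ) (C : ℝ) : Prop :=
  0 < C ∧
    ∀ K : Set (Act d), K.Nonempty → IsClosed K → (∀ x ∈ K, ‖x‖ ≤ D / 2) →
    ∀ m ≤ T, ∀ (f : ℕ → Act d → ℝ) (z : ℕ → Act d),
      (∀ s < m, AdmissibleCost K G (f s)) → (∀ s < m, z s ∈ K) →
      ∑ s ∈ Finset.range m,
          ∫ x, f s x ∂(alg.dist K s (fun i : Fin s => f i) (fun i : Fin s => z i))
        - bestFixed K (fun x => ∑ s ∈ Finset.range m, f s x) ≤ C * √m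

/-! ### The quantities computed by OSOCO (rounds are numbered `1, 2, …`) -/

/-- The weighted norm `‖x‖_W = √(xᵀ W x)`. -/
def wnorm {d : ℕ} (W : Matrix (Fin d) (Fin d) ℝ) (x : Act d) : ℝ :=
  √(x.ofLp ⬝ᵥ (W *ᵥ x.ofLp))

/-- `V_t = lam I + ∑_{s < t} x_s x_sᵀ`. -/
def gram {d : ℕ} (lam : ℝ) (x : ℕ → Act d) (t : ℕ) : Matrix (Fin d) (Fin d) ℝ :=
  lam • (1 : Matrix (Fin d) (Fin d) ℝ) +
    ∑ s ∈ Finset.Ico 1 t, vecMulVec (x s).ofLp (x s).ofLp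

/-- `S_t = ∑_{s < t} y_s x_sᵀ`. -/
def cross {n d : ℕ} (x : ℕ → Act d) (y : ℕ → Fin n → ℝ) (t : ℕ) :
    Matrix (Fin n) (Fin d) ℝ :=
  ∑ s ∈ Finset.Ico 1 t, vecMulVec (y s) (x s).ofLp

/-- The first round of the phase to which round `t ≥ 1` belongs: round `t + 1` opens a new phase
iff `det V_{t+1} > 2 det V̄`, where `V̄` is the Gram matrix at the start of the current phase. -/
def phaseStart {d : ℕ} (lam : ℝ) (x : ℕ → Act d) : ℕ → ℕ
  | 0 => 1
  | t + 1 =>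
    if (gram lam x (t + 1)).det ≤ 2 * (gram lam x (phaseStart lam x t)).det
    then phaseStart lam x t else t + 1

/-- The set of `x ∈ X` with `Â x + c ‖x‖_{V⁻¹} 𝟏 ≤ b - κ 𝟏`, where `Â = S V⁻¹`. With `c` the
confidence radius it is the pessimistic set, with `c` minus that radius the optimistic set. -/
def estSet {n d : ℕ} (X : Set (Act d)) (b : Fin n → ℝ) (κ c : ℝ)
    (S : Matrix (Fin n) (Fin d) ℝ) (V : Matrix (Fin d) (Fin d) ℝ) : Set (Act d) :=
  {x | x ∈ X ∧ ∀ i, ((S * V⁻¹) *ᵥ x.ofLp) i + c * wnorm V⁻¹ x ≤ b i - κ}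

/-- The pessimistic action set in force in round `t`. -/
def pessSet {n d : ℕ} (X : Set (Act d)) (b : Fin n → ℝ) (lam κ : ℝ) (β : ℕ → ℝ)
    (x : ℕ → Act d) (y : ℕ → Fin n → ℝ) (t : ℕ) : Set (Act d) :=
  estSet X b κ (β (phaseStart lam x t))
    (cross x y (phaseStart lam x t)) (gram lam x (phaseStart lam x t))

/-- The optimistic action set in force in round `t`. -/
def optSet {n d : ℕ} (X : Set (Act d)) (b : Fin n → ℝ) (lam κ : ℝ) (β : ℕ → ℝ)
    (x : ℕ → Act d) (y : ℕ → Fin n → ℝ) (t : ℕ) : Set (Act d) :=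
  estSet X b κ (-β (phaseStart lam x t))
    (cross x y (phaseStart lam x t)) (gram lam x (phaseStart lam x t))

/-- The safe scaling `max {μ ∈ [0, 1] : μ v ∈ Y}`. -/
def safeScale {d : ℕ} (Y : Set (Act d)) (v : Act d) : ℝ :=
  sSup {μ : ℝ | μ ∈ Set.Icc (0 : ℝ) 1 ∧ μ • v ∈ Y}

/-- The constraint feedback `y_t = A x_t + ε_t`. -/
def feedback {n d : ℕ} (A : Matrix (Fin n) (Fin d) ℝ) (x : ℕ → Act d) (ε : ℕ → Fin n → ℝ)
    (t : ℕ) : Fin n → ℝ :=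
  A *ᵥ (x t).ofLp + ε t

/-- The confidence radius
`β_t = ρ √(d log ((1 + (t - 1) D² / lam) / (δ / n))) + √lam S`. -/
def confRadius (n d : ℕ) (ρ D S lam δ : ℝ) (t : ℕ) : ℝ :=
  ρ * √(d * Real.log ((1 + ((t : ℝ) - 1) * D ^ 2 / lam) / (δ / n))) + √lam * S

/-! ### The game -/

variable {Ω : Type*} {mΩ : MeasurableSpace Ω}

/-- The σ-algebra generated by `x_1, ε_1, …, x_{t-1}, ε_{t-1}, x_t`. -/
abbrev noiseInfo {n d : ℕ} (x : ℕ → Ω → Act d) (ε : ℕ → Ω → Fin n → ℝ) (t : ℕ) :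
    MeasurableSpace Ω :=
  (⨆ s ∈ Set.Icc 1 t, MeasurableSpace.comap (x s) inferInstance) ⊔
    (⨆ s ∈ Set.Ico 1 t, MeasurableSpace.comap (ε s) inferInstance)

/-- The real random variable `Z` has conditional mean zero and is conditionally `ρ`-subgaussian
given the σ-algebra `m`. -/
def CondSubgaussian (μ : Measure Ω) (m : MeasurableSpace Ω) (Z : Ω → ℝ) (ρ : ℝ) : Prop :=
  Integrable Z μ ∧ μ[Z | m] =ᵐ[μ] 0 ∧
    ∀ l : ℝ, Integrable (fun ω => Real.exp (l * Z ω)) μ ∧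
      μ[fun ω => Real.exp (l * Z ω) | m] ≤ᵐ[μ] fun _ => Real.exp (l ^ 2 * ρ ^ 2 / 2)

/-- The processes `xt` (points sampled by the subroutine), `x` (actions played), `f` (costs) and
`ε` (noise) form `T` rounds of the game in which the player runs OSOCO with the subroutine `alg`,
regularization `lam`, tightening `κ` and confidence radii `β`. The σ-algebra `ℱ t` contains all
that has happened up to and including round `t` (it may be larger, so that the adversary may
randomize). -/
structure IsRun {n d : ℕ} (μ : Measure Ω) (ℱ : Filtration ℕ mΩ) (alg : OnlineAlgorithm d)
    (X : Set (Act d)) (A : Matrix (Fin n) (Fin d) ℝ) (b : Fin n → ℝ) (T : ℕ)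
    (lam κ : ℝ) (β : ℕ → ℝ) (xt x : ℕ → Ω → Act d) (f : ℕ → Ω → Act d → ℝ)
    (ε : ℕ → Ω → Fin n → ℝ) : Prop where
  meas_sample : ∀ t ∈ Set.Icc 1 T, Measurable[ℱ t] (xt t)
  meas_noise : ∀ t ∈ Set.Icc 1 T, Measurable[ℱ t] (ε t)
  /-- The adversary chooses `f_t` knowing only what happened before round `t`. -/
  meas_cost : ∀ t ∈ Set.Icc 1 T, ∀ u ∈ X, Measurable[ℱ (t - 1)] (fun ω => f t ω u)
  /-- Given the past, `xt_t` is drawn from the distribution chosen by the subroutine, which was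
  started at the beginning of the current phase with the optimistic set as its action set, and
  has since received the costs of this phase. -/
  sample_law : ∀ t ∈ Set.Icc 1 T, ∀ B : Set (Act d), MeasurableSet B →
    μ[(xt t ⁻¹' B).indicator (fun _ => (1 : ℝ)) | ℱ (t - 1)] =ᵐ[μ] fun ω =>
      let xs : ℕ → Act d := fun s => x s ω
      let y : ℕ → Fin n → ℝ := feedback A xs (fun s => ε s ω)
      let t₀ := phaseStart lam xs t
      (alg.dist (optSet X b lam κ β xs y t) (t - t₀)
        (fun i => f (t₀ + i) ω) (fun i => xt (t₀ + i) ω)).real B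
  /-- The action played is the safely scaled sample. -/
  play : ∀ t ∈ Set.Icc 1 T, ∀ ω,
    let xs : ℕ → Act d := fun s => x s ω
    let y : ℕ → Fin n → ℝ := feedback A xs (fun s => ε s ω)
    x t ω = safeScale (pessSet X b lam κ β xs y t) (xt t ω) • xt t ω

/-- The feasible set `{x ∈ X : A x ≤ b}`. -/
def feasible {n d : ℕ} (X : Set (Act d)) (A : Matrix (Fin n) (Fin d) ℝ) (b : Fin n → ℝ) :
    Set (Act d) :=
  {u | u ∈ X ∧ A *ᵥ u.ofLp ≤ b}

/-- The regret `R_T = ∑_{t ≤ T} f_t(x_t) - min_{u feasible} ∑_{t ≤ T} f_t(u)`. -/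
def regret {n d : ℕ} (X : Set (Act d)) (A : Matrix (Fin n) (Fin d) ℝ) (b : Fin n → ℝ) (T : ℕ)
    (f : ℕ → Act d → ℝ) (x : ℕ → Act d) : ℝ :=
  ∑ t ∈ Finset.Icc 1 T, f t (x t)
    - bestFixed (feasible X A b) (fun u => ∑ t ∈ Finset.Icc 1 T, f t u)

end OSOCO

end

noncomputable section

namespace OSOCO

/-! ### Rank-one updates of positive definite matrices -/

section RankOne

variable {ι : Type*} [Fintype ι] [DecidableEq ι] {V : Matrix ι ι ℝ}

/-! Two events of probability at most δ are discarded; off them, up to a null set, the argument is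
the deterministic `regret_le_and_safe`.

The first event is that some row of the least squares estimate leaves its confidence ellipsoid. For
each row, `selfNormalized` is a nonnegative supermartingale, since its successive ratio is a
one-dimensional Gaussian mixture of subgaussian exponentials. The maximal inequality then controls
all rounds at once (`measure_noiseSum_gt_le`), and a union bound over the rows uses levels δ/n. The
second event is that the sampled costs exceed their conditional means by too much in total, which
Azuma–Hoeffding excludes (`measure_sum_sub_integral_gt_le`). Here `IsRun.ae_sample` identifies those
means with the expected costs in the regret guarantee of the subroutine.

On the remaining event every pessimistic set consists of safe actions and every optimistic set
contains the feasible set. The regret splits into three sums. The loss from scaling samples down is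
governed by `one_sub_safeScale_le` and the elliptical potential; the determinant test lets the
matrix frozen at the phase start replace the current one at a factor √2 (`sum_cost_sub_le`). The
sampling deviation is the Azuma term. The regret of the restarted subroutine is a sum of square
roots of phase lengths (`sum_expCost_sub_le`); since the determinant doubles from phase to phase,
there are only O(d log T) phases. -/

lemma posDef_dotProduct_inv_nonneg (hV : V.PosDef) (u : ι → ℝ) : 0 ≤ u ⬝ᵥ (V⁻¹ *ᵥ u) := by
  simpa using hV.inv.posSemidef.dotProduct_mulVec_nonneg u

lemma posDef_dotProduct_inv_comm (hV : V.PosDef) (u v : ι → ℝ) :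
    u ⬝ᵥ (V⁻¹ *ᵥ v) = v ⬝ᵥ (V⁻¹ *ᵥ u) := by
  have h : V⁻¹ᵀ = V⁻¹ := by simpa [IsSymm] using hV.inv.isHermitian
  rw [dotProduct_mulVec, ← mulVec_transpose, h, dotProduct_comm]

lemma posDef_dotProduct_inv_sq_le (hV : V.PosDef) (u v : ι → ℝ) :
    (u ⬝ᵥ (V⁻¹ *ᵥ v)) ^ 2 ≤ (u ⬝ᵥ (V⁻¹ *ᵥ u)) * (v ⬝ᵥ (V⁻¹ *ᵥ v)) := by
  have key : ∀ s : ℝ, 0 ≤ (v ⬝ᵥ (V⁻¹ *ᵥ v)) * (s * s) + (2 * (u ⬝ᵥ (V⁻¹ *ᵥ v))) * s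
      + u ⬝ᵥ (V⁻¹ *ᵥ u) := by
    intro s
    have h := posDef_dotProduct_inv_nonneg hV (u + s • v)
    simp only [mulVec_add, mulVec_smul, add_dotProduct, dotProduct_add, smul_dotProduct,
      dotProduct_smul, smul_eq_mul, posDef_dotProduct_inv_comm hV v u] at h
    linarith
  have := discrim_le_zero key
  rw [discrim] at this
  nlinarith

lemma det_add_vecMulVec_self (hV : V.PosDef) (x : ι → ℝ) :
    (V + vecMulVec x x).det = V.det * (1 + x ⬝ᵥ (V⁻¹ *ᵥ x)) := by
  rw [vecMulVec_eq Unit, det_add_replicateCol_mul_replicateRow (ι := Unit) hV.det_pos.ne'.isUnit,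
    Matrix.mul_assoc, ← replicateCol_mulVec (ι := Unit), det_unique (n := Unit)]
  simp [Matrix.replicateRow_mul_replicateCol_apply]

/-- Sherman–Morrison formula, checked by multiplying out. -/
lemma inv_add_vecMulVec_self (hV : V.PosDef) (x : ι → ℝ) :
    (V + vecMulVec x x)⁻¹ =
      V⁻¹ - (1 + x ⬝ᵥ (V⁻¹ *ᵥ x))⁻¹ • vecMulVec (V⁻¹ *ᵥ x) (V⁻¹ *ᵥ x) := by
  have hw : 1 + x ⬝ᵥ (V⁻¹ *ᵥ x) ≠ 0 := by
    have := posDef_dotProduct_inv_nonneg hV x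
    positivity
  have ht : V⁻¹ᵀ = V⁻¹ := by simpa [IsSymm] using hV.inv.isHermitian
  have hVV : V * V⁻¹ = 1 := mul_nonsing_inv _ hV.det_pos.ne'.isUnit
  apply inv_eq_right_inv
  have h1 : V * vecMulVec (V⁻¹ *ᵥ x) (V⁻¹ *ᵥ x) = vecMulVec x (V⁻¹ *ᵥ x) := by
    rw [mul_vecMulVec, mulVec_mulVec, hVV, one_mulVec]
  have h2 : vecMulVec x x * V⁻¹ = vecMulVec x (V⁻¹ *ᵥ x) := by
    rw [vecMulVec_mul, ← mulVec_transpose, ht]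
  have h3 : vecMulVec x x * vecMulVec (V⁻¹ *ᵥ x) (V⁻¹ *ᵥ x)
      = (x ⬝ᵥ (V⁻¹ *ᵥ x)) • vecMulVec x (V⁻¹ *ᵥ x) := by
    rw [vecMulVec_mul_vecMulVec, ← smul_vecMulVec, vecMulVec_smul, smul_vecMulVec]
  rw [Matrix.mul_sub, Matrix.mul_smul, Matrix.add_mul, Matrix.add_mul, h1, h2, h3, hVV]
  ext i j
  simp only [Matrix.sub_apply, Matrix.add_apply, Matrix.smul_apply, smul_eq_mul]
  field_simp
  ring

lemma dotProduct_inv_add_vecMulVec_self (hV : V.PosDef) (x u v : ι → ℝ) :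
    u ⬝ᵥ ((V + vecMulVec x x)⁻¹ *ᵥ v) =
      u ⬝ᵥ (V⁻¹ *ᵥ v) - (u ⬝ᵥ (V⁻¹ *ᵥ x)) * (x ⬝ᵥ (V⁻¹ *ᵥ v)) / (1 + x ⬝ᵥ (V⁻¹ *ᵥ x)) := by
  rw [inv_add_vecMulVec_self hV, sub_mulVec, smul_mulVec, vecMulVec_mulVec, dotProduct_sub,
    dotProduct_smul, op_smul_eq_smul, dotProduct_smul, posDef_dotProduct_inv_comm hV x v,
    dotProduct_comm (V⁻¹ *ᵥ x) v]
  simp only [smul_eq_mul]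
  ring

lemma dotProduct_inv_add_vecMulVec_self_le (hV : V.PosDef) (x u : ι → ℝ) :
    u ⬝ᵥ ((V + vecMulVec x x)⁻¹ *ᵥ u) ≤ u ⬝ᵥ (V⁻¹ *ᵥ u) := by
  have hw := posDef_dotProduct_inv_nonneg hV x
  rw [dotProduct_inv_add_vecMulVec_self hV, posDef_dotProduct_inv_comm hV x u]
  have : 0 ≤ u ⬝ᵥ (V⁻¹ *ᵥ x) * u ⬝ᵥ (V⁻¹ *ᵥ x) / (1 + x ⬝ᵥ (V⁻¹ *ᵥ x)) := by
    have := mul_self_nonneg (u ⬝ᵥ (V⁻¹ *ᵥ x))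
    positivity
  linarith

/-- After Sherman–Morrison and the determinant lemma, the difference of the two sides is det V times
a Cauchy–Schwarz defect. This bounds the norm for an outdated Gram matrix by the current norm, at
the price of the determinant ratio. -/
lemma dotProduct_inv_mul_det_le (hV : V.PosDef) (x u : ι → ℝ) :
    u ⬝ᵥ (V⁻¹ *ᵥ u) * V.det ≤
      u ⬝ᵥ ((V + vecMulVec x x)⁻¹ *ᵥ u) * (V + vecMulVec x x).det := by
  have hw := posDef_dotProduct_inv_nonneg hV x
  have hcs := posDef_dotProduct_inv_sq_le hV u x
  rw [dotProduct_inv_add_vecMulVec_self hV, posDef_dotProduct_inv_comm hV x u,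
    det_add_vecMulVec_self hV]
  have hd := hV.det_pos
  have : (u ⬝ᵥ (V⁻¹ *ᵥ u) - u ⬝ᵥ (V⁻¹ *ᵥ x) * u ⬝ᵥ (V⁻¹ *ᵥ x) / (1 + x ⬝ᵥ (V⁻¹ *ᵥ x)))
      * (V.det * (1 + x ⬝ᵥ (V⁻¹ *ᵥ x))) = (u ⬝ᵥ (V⁻¹ *ᵥ u) +
      (u ⬝ᵥ (V⁻¹ *ᵥ u) * x ⬝ᵥ (V⁻¹ *ᵥ x) - (u ⬝ᵥ (V⁻¹ *ᵥ x)) ^ 2)) * V.det := by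
    field_simp
    ring
  rw [this]
  gcongr
  linarith

end RankOne

/-! ### Gram matrices of the played actions -/

section Gram

variable {d : ℕ} {lam : ℝ} {x : ℕ → Act d}

lemma gram_succ (lam : ℝ) (x : ℕ → Act d) {t : ℕ} (ht : 1 ≤ t) :
    gram lam x (t + 1) = gram lam x t + vecMulVec (x t).ofLp (x t).ofLp := by
  rw [gram, gram, Finset.sum_Ico_succ_top ht, add_assoc]

lemma gram_one (lam : ℝ) (x : ℕ → Act d) : gram lam x 1 = lam • 1 := by simp [gram]

lemma gram_posDef (hlam : 0 < lam) (x : ℕ → Act d) (t : ℕ) : (gram lam x t).PosDef :=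
  (PosDef.one.smul hlam).add_posSemidef <| posSemidef_sum _ fun s _ => by
    simpa using posSemidef_vecMulVec_self_star (x s).ofLp

lemma dotProduct_gram_inv_mul_det_le (hlam : 0 < lam) (x : ℕ → Act d) {s t : ℕ} (hs : 1 ≤ s)
    (hst : s ≤ t) (u : Fin d → ℝ) :
    u ⬝ᵥ ((gram lam x s)⁻¹ *ᵥ u) * (gram lam x s).det ≤
      u ⬝ᵥ ((gram lam x t)⁻¹ *ᵥ u) * (gram lam x t).det := by
  induction t, hst using Nat.le_induction with
  | base => exact le_rfl
  | succ t hst ih =>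
    rw [gram_succ lam x (hs.trans hst)]
    exact ih.trans (dotProduct_inv_mul_det_le (gram_posDef hlam x t) _ u)

lemma dotProduct_gram_inv_le (hlam : 0 < lam) (x : ℕ → Act d) {t : ℕ} (ht : 1 ≤ t)
    (u : Fin d → ℝ) : lam * (u ⬝ᵥ ((gram lam x t)⁻¹ *ᵥ u)) ≤ u ⬝ᵥ u := by
  induction t, ht using Nat.le_induction with
  | base =>
    have : (lam • (1 : Matrix (Fin d) (Fin d) ℝ))⁻¹ = lam⁻¹ • 1 := by
      apply inv_eq_right_inv
      simp [smul_smul, hlam.ne']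
    rw [gram_one, this, smul_mulVec, one_mulVec, dotProduct_smul, smul_eq_mul,
      mul_inv_cancel_left₀ hlam.ne']
  | succ t ht ih =>
    rw [gram_succ lam x ht]
    refine le_trans ?_ ih
    gcongr
    exact dotProduct_inv_add_vecMulVec_self_le (gram_posDef hlam x t) _ u

lemma ofLp_dotProduct_self (u : Act d) : u.ofLp ⬝ᵥ u.ofLp = ‖u‖ ^ 2 := by
  rw [EuclideanSpace.norm_sq_eq]
  simp [dotProduct, sq]

lemma dotProduct_gram_mulVec (lam : ℝ) (x : ℕ → Act d) (t : ℕ) (v : Fin d → ℝ) :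
    v ⬝ᵥ (gram lam x t *ᵥ v) = lam * (v ⬝ᵥ v) + ∑ s ∈ Finset.Ico 1 t, ((x s).ofLp ⬝ᵥ v) ^ 2 := by
  rw [gram, add_mulVec, dotProduct_add, smul_mulVec, one_mulVec, dotProduct_smul, smul_eq_mul,
    sum_mulVec, dotProduct_sum]
  congr 1
  refine Finset.sum_congr rfl fun s _ => ?_
  rw [vecMulVec_mulVec, op_smul_eq_smul, dotProduct_smul, smul_eq_mul, dotProduct_comm v, sq]

/-- Each eigenvalue is a Rayleigh quotient at a unit eigenvector, where every rank-one term
contributes at most B. -/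
lemma det_gram_le (hlam : 0 < lam) (x : ℕ → Act d) (t : ℕ) {B : ℝ}
    (hx : ∀ s ∈ Finset.Ico 1 t, ‖x s‖ ^ 2 ≤ B) :
    (gram lam x t).det ≤ (lam + (t - 1 : ℕ) * B) ^ d := by
  have hV := gram_posDef hlam x t
  rw [hV.isHermitian.det_eq_prod_eigenvalues]
  calc ∏ i, ((hV.isHermitian.eigenvalues i : ℝ))
      ≤ ∏ _i : Fin d, (lam + (t - 1 : ℕ) * B) := by
        refine Finset.prod_le_prod (fun i _ => (hV.eigenvalues_pos i).le) fun i _ => ?_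
        rw [hV.isHermitian.eigenvalues_eq i]
        set v := hV.isHermitian.eigenvectorBasis i
        have hv : ‖v‖ = 1 := hV.isHermitian.eigenvectorBasis.orthonormal.1 i
        simp only [star_trivial, RCLike.re_to_real]
        rw [dotProduct_gram_mulVec, ofLp_dotProduct_self, hv]
        have : ∑ s ∈ Finset.Ico 1 t, ((x s).ofLp ⬝ᵥ v.ofLp) ^ 2 ≤ ∑ s ∈ Finset.Ico 1 t, B := by
          refine Finset.sum_le_sum fun s hs => le_trans ?_ (hx s hs)
          have h := abs_real_inner_le_norm v (x s)
          rw [hv, one_mul, EuclideanSpace.inner_eq_star_dotProduct] at h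
          simp only [star_trivial] at h
          rw [← sq_abs]
          gcongr
        simp only [Finset.sum_const, Nat.card_Ico, nsmul_eq_mul] at this
        linarith
    _ = _ := by simp

lemma det_gram_succ (hlam : 0 < lam) (x : ℕ → Act d) {t : ℕ} (ht : 1 ≤ t) :
    (gram lam x (t + 1)).det = (gram lam x t).det *
      (1 + (x t).ofLp ⬝ᵥ ((gram lam x t)⁻¹ *ᵥ (x t).ofLp)) := by
  rw [gram_succ lam x ht, det_add_vecMulVec_self (gram_posDef hlam x t)]

lemma half_le_log_one_add {w : ℝ} (h0 : 0 ≤ w) (h1 : w ≤ 1) : w / 2 ≤ Real.log (1 + w) := by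
  have h : 1 - (1 + w)⁻¹ ≤ Real.log (1 + w) := Real.one_sub_inv_le_log_of_pos (by linarith)
  refine le_trans ?_ h
  have : 1 - (1 + w)⁻¹ = w / (1 + w) := by field_simp; ring
  rw [this]
  gcongr
  linarith

/-- The elliptical potential lemma. -/
lemma sum_dotProduct_gram_inv_le (hlam : 0 < lam) (x : ℕ → Act d) {t : ℕ} (ht : 1 ≤ t)
    (hx : ∀ s ∈ Finset.Ico 1 t, ‖x s‖ ^ 2 ≤ lam) :
    ∑ s ∈ Finset.Ico 1 t, (x s).ofLp ⬝ᵥ ((gram lam x s)⁻¹ *ᵥ (x s).ofLp) ≤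
      2 * Real.log ((gram lam x t).det / lam ^ d) := by
  induction t, ht using Nat.le_induction with
  | base => simp [gram_one, hlam.ne']
  | succ t ht ih =>
    rw [Finset.sum_Ico_succ_top ht, det_gram_succ hlam x ht]
    have h1 := ih fun s hs => hx s (Finset.Ico_subset_Ico_right (Nat.le_succ t) hs)
    set w := (x t).ofLp ⬝ᵥ ((gram lam x t)⁻¹ *ᵥ (x t).ofLp)
    have hw0 : 0 ≤ w := posDef_dotProduct_inv_nonneg (gram_posDef hlam x t) _
    -- Since V ≥ lam I and ‖x‖² ≤ lam, the term lies in the range where w/2 ≤ log (1 + w).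
    have hw1 : w ≤ 1 := by
      have h := dotProduct_gram_inv_le hlam x ht (x t).ofLp
      rw [ofLp_dotProduct_self] at h
      have := h.trans (hx t (by simp [ht]))
      nlinarith
    have h2 := half_le_log_one_add hw0 hw1
    have hd := (gram_posDef hlam x t).det_pos
    rw [mul_div_right_comm, Real.log_mul (by positivity) (by positivity)]
    linarith

lemma wnorm_nonneg (W : Matrix (Fin d) (Fin d) ℝ) (u : Act d) : 0 ≤ wnorm W u := Real.sqrt_nonneg _

lemma wnorm_smul (W : Matrix (Fin d) (Fin d) ℝ) (c : ℝ) (u : Act d) :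
    wnorm W (c • u) = |c| * wnorm W u := by
  rw [wnorm, wnorm, WithLp.ofLp_smul, mulVec_smul, smul_dotProduct, dotProduct_smul, smul_eq_mul,
    smul_eq_mul, ← mul_assoc, Real.sqrt_mul (mul_self_nonneg c), Real.sqrt_mul_self_eq_abs]

lemma wnorm_inv_sq {V : Matrix (Fin d) (Fin d) ℝ} (hV : V.PosDef) (u : Act d) :
    wnorm V⁻¹ u ^ 2 = u.ofLp ⬝ᵥ (V⁻¹ *ᵥ u.ofLp) :=
  Real.sq_sqrt (posDef_dotProduct_inv_nonneg hV _)

lemma continuous_wnorm (W : Matrix (Fin d) (Fin d) ℝ) : Continuous (wnorm W) := by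
  unfold wnorm
  fun_prop

end Gram

/-! ### Convex costs with bounded gradients are Lipschitz -/

section Costs

variable {d : ℕ}

/-- The gradient exists only within K, so the cost is restricted to the segment from u to v and
differentiated from the right at 0; convexity bounds every slope by f v - f u. -/
lemma _root_.ConvexOn.add_inner_le_of_hasGradientWithinAt {K : Set (Act d)} {f : Act d → ℝ}
    (hf : ConvexOn ℝ K f) {u v g : Act d} (hu : u ∈ K) (hv : v ∈ K)
    (hg : HasGradientWithinAt f g K u) : f u + inner ℝ g (v - u) ≤ f v := by
  have hmem : ∀ r ∈ Set.Icc (0 : ℝ) 1, u + r • (v - u) ∈ K := fun r hr =>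
    hf.1.add_smul_sub_mem hu hv hr
  have hline : HasDerivWithinAt (fun r : ℝ => u + r • (v - u)) (v - u) (Set.Icc 0 1) 0 := by
    have := ((hasDerivAt_id (0 : ℝ)).smul_const (v - u)).const_add u
    simpa using this.hasDerivWithinAt
  have hderiv : HasDerivWithinAt (fun r : ℝ => f (u + r • (v - u))) (inner ℝ g (v - u))
      (Set.Icc 0 1) 0 := by
    have hg' : HasFDerivWithinAt f (InnerProductSpace.toDual ℝ (Act d) g) K
        (u + (0 : ℝ) • (v - u)) := by
      simpa using hg.hasFDerivWithinAt
    exact (hg'.comp_hasDerivWithinAt (0 : ℝ) hline hmem).congr_deriv (by simp)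
  rw [hasDerivWithinAt_iff_tendsto_slope] at hderiv
  have hne : Filter.NeBot (nhdsWithin (0 : ℝ) (Set.Icc 0 1 \ {0})) := by
    rw [Set.Icc_sdiff_left, nhdsWithin_Ioc_eq_nhdsGT one_pos]
    infer_instance
  have hle : inner ℝ g (v - u) ≤ f v - f u := by
    refine le_of_tendsto hderiv ?_
    filter_upwards [self_mem_nhdsWithin] with r hr
    rw [Set.Icc_sdiff_left] at hr
    have h := hf.2 hu hv (sub_nonneg.2 hr.2) hr.1.le (by ring)
    have he : (1 - r) • u + r • v = u + r • (v - u) := by module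
    rw [he, smul_eq_mul, smul_eq_mul] at h
    rw [slope_def_field]
    simp only [zero_smul, add_zero, sub_zero]
    rw [div_le_iff₀ hr.1]
    linarith
  linarith

lemma AdmissibleCost.mono {K L : Set (Act d)} {G : ℝ} {f : Act d → ℝ}
    (hf : AdmissibleCost L G f) (hKL : K ⊆ L) : AdmissibleCost K G f := by
  have h := convexHull_mono (𝕜 := ℝ) hKL
  refine ⟨hf.1.subset h (convex_convexHull ℝ K), fun u hu => ?_⟩
  obtain ⟨g, hg, hG⟩ := hf.2 u (hKL hu)
  exact ⟨g, (HasFDerivWithinAt.mono hg.hasFDerivWithinAt h :), hG⟩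

lemma AdmissibleCost.sub_le {K : Set (Act d)} (hK : Convex ℝ K) {G : ℝ} {f : Act d → ℝ}
    (hf : AdmissibleCost K G f) {u v : Act d} (hu : u ∈ K) (hv : v ∈ K) :
    f u - f v ≤ G * ‖u - v‖ := by
  obtain ⟨g, hg, hG⟩ := hf.2 u hu
  have hconv := hf.1
  rw [hK.convexHull_eq] at hg hconv
  have h := hconv.add_inner_le_of_hasGradientWithinAt hu hv hg
  have h2 := abs_real_inner_le_norm g (v - u)
  rw [norm_sub_rev v u] at h2
  have h3 : ‖g‖ * ‖u - v‖ ≤ G * ‖u - v‖ := by gcongr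
  have h4 := neg_abs_le (inner ℝ g (v - u))
  linarith

lemma AdmissibleCost.abs_sub_le {K : Set (Act d)} (hK : Convex ℝ K) {G : ℝ} {f : Act d → ℝ}
    (hf : AdmissibleCost K G f) {u v : Act d} (hu : u ∈ K) (hv : v ∈ K) :
    |f u - f v| ≤ G * ‖u - v‖ := by
  rw [abs_le]
  have h1 := hf.sub_le hK hu hv
  have h2 := hf.sub_le hK hv hu
  rw [norm_sub_rev] at h2
  constructor <;> linarith

lemma AdmissibleCost.nonneg {K : Set (Act d)} {G : ℝ} {f : Act d → ℝ}
    (hf : AdmissibleCost K G f) (hK : K.Nonempty) : 0 ≤ G := by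
  obtain ⟨u, hu⟩ := hK
  obtain ⟨g, -, hG⟩ := hf.2 u hu
  exact (norm_nonneg g).trans hG

/-- `bestFixed` is a real `sInf`, so a lower bound is needed before it can be compared with a value;
it comes from the Lipschitz property on a bounded set. -/
lemma bestFixed_sum_le {K X : Set (Act d)} (hX : Convex ℝ X) {G R : ℝ} (hKX : K ⊆ X)
    (hK : ∀ u ∈ X, ‖u‖ ≤ R) (m : ℕ) {f : ℕ → Act d → ℝ}
    (hf : ∀ s < m, AdmissibleCost X G (f s)) {u : Act d} (hu : u ∈ K) :
    bestFixed K (fun v => ∑ s ∈ Finset.range m, f s v) ≤ ∑ s ∈ Finset.range m, f s u := by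
  refine csInf_le ⟨∑ s ∈ Finset.range m, (f s u - G * (2 * R)), ?_⟩ ⟨u, hu, rfl⟩
  rintro _ ⟨v, hv, rfl⟩
  refine Finset.sum_le_sum fun s hs => ?_
  have hfs := hf s (Finset.mem_range.1 hs)
  have h := hfs.sub_le hX (hKX hu) (hKX hv)
  have hG := hfs.nonneg ⟨u, hKX hu⟩
  have h2 : ‖u - v‖ ≤ 2 * R := by
    linarith [norm_sub_le u v, hK u (hKX hu), hK v (hKX hv)]
  have : G * ‖u - v‖ ≤ G * (2 * R) := by gcongr
  linarith

end Costs

/-! ### Pessimistic and optimistic sets, safe scaling -/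

section Sets

variable {n d : ℕ} {X : Set (Act d)} {b : Fin n → ℝ} {c : ℝ} {S : Matrix (Fin n) (Fin d) ℝ}
  {V : Matrix (Fin d) (Fin d) ℝ}

lemma zero_mem_estSet (hX0 : (0 : Act d) ∈ X) (hb : ∀ i, 0 ≤ b i) :
    (0 : Act d) ∈ estSet X b 0 c S V :=
  ⟨hX0, fun i => by simpa [wnorm] using hb i⟩

lemma isClosed_estSet (hX : IsClosed X) : IsClosed (estSet X b 0 c S V) := by
  have : estSet X b 0 c S V = X ∩ ⋂ i, {u : Act d | ((S * V⁻¹) *ᵥ u.ofLp) i + c * wnorm V⁻¹ u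
      ≤ b i - 0} := by
    ext u
    simp [estSet]
  rw [this]
  refine hX.inter (isClosed_iInter fun i => isClosed_le ?_ continuous_const)
  have h1 : Continuous fun u : Act d => (S * V⁻¹) *ᵥ u.ofLp := by fun_prop
  exact ((continuous_apply i).comp h1).add (continuous_const.mul (continuous_wnorm _))

/-- The left side of each constraint is positively homogeneous and b ≥ 0, so the set is star-shaped
about 0, whatever the sign of c. -/
lemma estSet_smul (hX : Convex ℝ X) (hX0 : (0 : Act d) ∈ X) {v : Act d} {q r : ℝ}
    (hq : 0 ≤ q) (hr : q ≤ r) (hb : ∀ i, 0 ≤ b i)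
    (hv : r • v ∈ estSet X b 0 c S V) : q • v ∈ estSet X b 0 c S V := by
  rcases hq.eq_or_lt with rfl | hq
  · simpa using zero_mem_estSet hX0 hb
  have hr0 : 0 < r := hq.trans_le hr
  have hs0 : 0 ≤ q / r := by positivity
  have hs1 : q / r ≤ 1 := (div_le_one hr0).2 hr
  have he : q • v = (q / r) • r • v := by rw [smul_smul, div_mul_cancel₀ _ hr0.ne']
  rw [he]
  refine ⟨hX.smul_mem_of_zero_mem hX0 hv.1 ⟨hs0, hs1⟩, fun i => ?_⟩
  have h := hv.2 i
  set w := r • v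
  rw [wnorm_smul, abs_of_nonneg hs0, WithLp.ofLp_smul, mulVec_smul, Pi.smul_apply, smul_eq_mul]
  have : q / r * ((S * V⁻¹) *ᵥ w.ofLp) i + c * (q / r * wnorm V⁻¹ w)
      = q / r * (((S * V⁻¹) *ᵥ w.ofLp) i + c * wnorm V⁻¹ w) := by ring
  rw [this]
  calc _ ≤ q / r * (b i - 0) := by gcongr
    _ ≤ 1 * (b i - 0) := by
      have := hb i
      gcongr
    _ = _ := one_mul _

variable {Y : Set (Act d)}

lemma safeScale_mem (hY : IsClosed Y) (h0 : (0 : Act d) ∈ Y) (v : Act d) :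
    safeScale Y v ∈ {r : ℝ | r ∈ Set.Icc (0 : ℝ) 1 ∧ r • v ∈ Y} := by
  have hc : IsCompact {r : ℝ | r ∈ Set.Icc (0 : ℝ) 1 ∧ r • v ∈ Y} :=
    isCompact_Icc.inter_right (hY.preimage (by fun_prop : Continuous fun r : ℝ => r • v))
  exact hc.sSup_mem ⟨0, by simpa using h0⟩

lemma le_safeScale {v : Act d} {r : ℝ} (hr : r ∈ Set.Icc (0 : ℝ) 1) (hv : r • v ∈ Y) :
    r ≤ safeScale Y v :=
  le_csSup ⟨1, fun _ h => h.1.2⟩ ⟨hr, hv⟩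

/-- Scaling an optimistic action into the pessimistic set costs little. -/
lemma one_sub_safeScale_le (hX : Convex ℝ X) (hXc : IsClosed X) (hX0 : (0 : Act d) ∈ X)
    {bm : ℝ} (hbm : 0 < bm) (hb : ∀ i, bm ≤ b i) (hc : 0 ≤ c) {v : Act d}
    (hv : v ∈ estSet X b 0 (-c) S V) :
    1 - safeScale (estSet X b 0 c S V) v ≤
      2 * c / bm * wnorm V⁻¹ (safeScale (estSet X b 0 c S V) v • v) := by
  have hb0 : ∀ i, 0 ≤ b i := fun i => hbm.le.trans (hb i)
  have hγ := safeScale_mem (isClosed_estSet (b := b) (c := c) (S := S) (V := V) hXc)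
    (zero_mem_estSet hX0 hb0) v
  set γ := safeScale (estSet X b 0 c S V) v with hγdef
  have hN : 0 ≤ wnorm V⁻¹ v := wnorm_nonneg _ _
  rw [wnorm_smul, abs_of_nonneg hγ.1.1]
  set N := wnorm V⁻¹ v
  have hcN : 0 ≤ c * N := mul_nonneg hc hN
  have hden : 0 < bm + 2 * (c * N) := by positivity
  have hr : bm / (bm + 2 * (c * N)) ∈ Set.Icc (0 : ℝ) 1 :=
    ⟨by positivity, (div_le_one hden).2 (by linarith)⟩
  -- An optimistic v has estimate at most b + cN, hence pessimistic value at most b + 2cN; this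
  -- factor brings it below b because b ≥ bm.
  have hle : bm / (bm + 2 * (c * N)) ≤ γ := by
    refine le_safeScale hr ⟨hX.smul_mem_of_zero_mem hX0 hv.1 hr, fun i => ?_⟩
    have hi := hv.2 i
    rw [wnorm_smul, abs_of_nonneg hr.1, WithLp.ofLp_smul, mulVec_smul, Pi.smul_apply, smul_eq_mul]
    change _ + c * (_ * N) ≤ _
    change _ + -c * N ≤ _ at hi
    set a := ((S * V⁻¹) *ᵥ v.ofLp) i
    have he : bm / (bm + 2 * (c * N)) * a + c * (bm / (bm + 2 * (c * N)) * N)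
        = bm * (a + c * N) / (bm + 2 * (c * N)) := by ring
    rw [he, div_le_iff₀ hden]
    have h1 : bm * (a + c * N) ≤ bm * (b i + 2 * (c * N)) :=
      mul_le_mul_of_nonneg_left (by linarith) hbm.le
    have h2 := mul_le_mul_of_nonneg_right (hb i) hcN
    nlinarith
  -- Cleared of denominators, the bound reads bm (1 - γ) ≤ 2cNγ, so the weighted norm is that of the
  -- scaled action γv, which is the one entering the Gram matrix.
  rw [div_le_iff₀ hden] at hle
  have : 2 * c / bm * (γ * N) = 2 * (c * N) * γ / bm := by ring
  rw [this, le_div_iff₀ hbm]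
  nlinarith

end Sets

/-! ### Phases -/

section Phases

variable {d : ℕ} {lam : ℝ} {x : ℕ → Act d}

lemma one_le_phaseStart (lam : ℝ) (x : ℕ → Act d) (t : ℕ) : 1 ≤ phaseStart lam x t := by
  induction t with
  | zero => exact le_rfl
  | succ t ih =>
    rw [phaseStart]
    split_ifs
    exacts [ih, Nat.succ_le_succ (Nat.zero_le t)]

lemma phaseStart_one (lam : ℝ) (x : ℕ → Act d) : phaseStart lam x 1 = 1 := by
  rw [phaseStart, phaseStart, ite_self]

lemma phaseStart_le (lam : ℝ) (x : ℕ → Act d) {t : ℕ} (ht : 1 ≤ t) :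
    phaseStart lam x t ≤ t := by
  induction t, ht using Nat.le_induction with
  | base => exact (phaseStart_one lam x).le
  | succ t ht ih =>
    rw [phaseStart]
    split_ifs
    exacts [ih.trans (Nat.le_succ t), le_rfl]

lemma det_gram_le_phaseStart (hlam : 0 < lam) (x : ℕ → Act d) {t : ℕ} (ht : 1 ≤ t) :
    (gram lam x t).det ≤ 2 * (gram lam x (phaseStart lam x t)).det := by
  obtain ⟨t, rfl⟩ := Nat.exists_eq_add_of_le' ht
  rw [phaseStart]
  split_ifs with h
  · exact h
  · linarith [(gram_posDef hlam x (t + 1)).det_pos]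

lemma phaseStart_eq_of_mem (lam : ℝ) (x : ℕ → Act d) {s t : ℕ}
    (hs : phaseStart lam x t ≤ s) (hst : s ≤ t) : phaseStart lam x s = phaseStart lam x t := by
  induction t with
  | zero => rw [Nat.le_zero.1 hst]
  | succ t ih =>
    rcases hst.eq_or_lt with rfl | hst
    · rfl
    rw [phaseStart] at hs ⊢
    split_ifs at hs ⊢ with h
    · exact ih hs (Nat.lt_succ_iff.1 hst)
    · omega

end Phases

/-! ### The least squares estimator -/

section Estimate

variable {n d : ℕ} {lam : ℝ}

/-- The accumulated noise `∑_{s < t} ε_s x_s` in one row of the constraints. -/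
def noiseSum (x : ℕ → Act d) (e : ℕ → ℝ) (t : ℕ) : Fin d → ℝ :=
  ∑ s ∈ Finset.Ico 1 t, e s • (x s).ofLp

lemma noiseSum_succ (x : ℕ → Act d) (e : ℕ → ℝ) {t : ℕ} (ht : 1 ≤ t) :
    noiseSum x e (t + 1) = noiseSum x e t + e t • (x t).ofLp :=
  Finset.sum_Ico_succ_top ht _

/-- Substituting the feedback gives S = A (V - lam I) + noise, read here in row i. -/
lemma cross_feedback_mulVec (lam : ℝ) (A : Matrix (Fin n) (Fin d) ℝ) (x : ℕ → Act d)
    (ε : ℕ → Fin n → ℝ) (t : ℕ) (v : Fin d → ℝ) (i : Fin n) :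
    (cross x (feedback A x ε) t *ᵥ v) i =
      (A *ᵥ (gram lam x t *ᵥ v)) i - lam * (A *ᵥ v) i + noiseSum x (fun s => ε s i) t ⬝ᵥ v := by
  have h1 : cross x (feedback A x ε) t *ᵥ v = A *ᵥ (∑ s ∈ Finset.Ico 1 t, ((x s).ofLp ⬝ᵥ v) •
      (x s).ofLp) + ∑ s ∈ Finset.Ico 1 t, ((x s).ofLp ⬝ᵥ v) • ε s := by
    rw [cross, sum_mulVec, mulVec_sum, ← Finset.sum_add_distrib]
    refine Finset.sum_congr rfl fun s _ => ?_
    rw [vecMulVec_mulVec, op_smul_eq_smul, feedback, smul_add, mulVec_smul]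
  have h2 : gram lam x t *ᵥ v = lam • v + ∑ s ∈ Finset.Ico 1 t, ((x s).ofLp ⬝ᵥ v) •
      (x s).ofLp := by
    rw [gram, add_mulVec, smul_mulVec, one_mulVec, sum_mulVec]
    congr 1
    refine Finset.sum_congr rfl fun s _ => ?_
    rw [vecMulVec_mulVec, op_smul_eq_smul]
  rw [h1, h2, mulVec_add, mulVec_smul, noiseSum, sum_dotProduct]
  simp only [Pi.add_apply, Pi.smul_apply, smul_eq_mul, Finset.sum_apply, smul_dotProduct]
  have : ∑ s ∈ Finset.Ico 1 t, (x s).ofLp ⬝ᵥ v * ε s i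
      = ∑ s ∈ Finset.Ico 1 t, ε s i * (x s).ofLp ⬝ᵥ v :=
    Finset.sum_congr rfl fun s _ => mul_comm _ _
  rw [this]
  ring

/-- The error is a noise term minus a regularization bias. Cauchy–Schwarz in the V⁻¹ inner product
handles both; the bias uses V ≥ lam I, which turns lam into √lam. -/
lemma abs_estimate_sub_le (hlam : 0 < lam) (A : Matrix (Fin n) (Fin d) ℝ) (x : ℕ → Act d)
    (ε : ℕ → Fin n → ℝ) {t : ℕ} (ht : 1 ≤ t) (u : Act d) (i : Fin n) {S r : ℝ}
    (hA : ‖(WithLp.toLp 2 (A i) : Act d)‖ ≤ S) (hr0 : 0 ≤ r)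
    (hr : noiseSum x (fun s => ε s i) t ⬝ᵥ ((gram lam x t)⁻¹ *ᵥ noiseSum x (fun s => ε s i) t)
      ≤ r ^ 2) :
    |((cross x (feedback A x ε) t * (gram lam x t)⁻¹) *ᵥ u.ofLp) i - (A *ᵥ u.ofLp) i| ≤
      (r + √lam * S) * wnorm (gram lam x t)⁻¹ u := by
  have hV := gram_posDef hlam x t
  have hVV : gram lam x t * (gram lam x t)⁻¹ = 1 := mul_nonsing_inv _ hV.det_pos.ne'.isUnit
  set V := gram lam x t
  set e := noiseSum x (fun s => ε s i) t
  have hS : 0 ≤ S := (norm_nonneg _).trans hA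
  have hN := wnorm_nonneg V⁻¹ u
  have hNsq := wnorm_inv_sq hV u
  set N := wnorm V⁻¹ u
  have h1 : |e ⬝ᵥ (V⁻¹ *ᵥ u.ofLp)| ≤ r * N := by
    refine abs_le_of_sq_le_sq ?_ (by positivity)
    rw [mul_pow, hNsq]
    refine (posDef_dotProduct_inv_sq_le hV _ _).trans ?_
    gcongr
    exact posDef_dotProduct_inv_nonneg hV _
  have h2 : |lam * (A i ⬝ᵥ (V⁻¹ *ᵥ u.ofLp))| ≤ √lam * S * N := by
    refine abs_le_of_sq_le_sq ?_ (by positivity)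
    have h3 := posDef_dotProduct_inv_sq_le hV (A i) u.ofLp
    have h4 := dotProduct_gram_inv_le hlam x ht (A i)
    have h5 : A i ⬝ᵥ A i ≤ S ^ 2 := by
      have := ofLp_dotProduct_self (WithLp.toLp 2 (A i) : Act d)
      simp only at this
      rw [this]
      gcongr
    rw [mul_pow, mul_pow, mul_pow, Real.sq_sqrt hlam.le, hNsq]
    have h6 := posDef_dotProduct_inv_nonneg hV u.ofLp
    calc lam ^ 2 * (A i ⬝ᵥ (V⁻¹ *ᵥ u.ofLp)) ^ 2
        ≤ lam ^ 2 * ((A i ⬝ᵥ (V⁻¹ *ᵥ A i)) * (u.ofLp ⬝ᵥ (V⁻¹ *ᵥ u.ofLp))) := by gcongr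
      _ = lam * (lam * (A i ⬝ᵥ (V⁻¹ *ᵥ A i))) * (u.ofLp ⬝ᵥ (V⁻¹ *ᵥ u.ofLp)) := by ring
      _ ≤ lam * S ^ 2 * (u.ofLp ⬝ᵥ (V⁻¹ *ᵥ u.ofLp)) := by
        gcongr
        exact h4.trans h5
  have h3 : ((cross x (feedback A x ε) t * V⁻¹) *ᵥ u.ofLp) i - (A *ᵥ u.ofLp) i
      = e ⬝ᵥ (V⁻¹ *ᵥ u.ofLp) - lam * (A i ⬝ᵥ (V⁻¹ *ᵥ u.ofLp)) := by
    rw [← mulVec_mulVec, cross_feedback_mulVec lam, mulVec_mulVec _ V, hVV, one_mulVec]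
    change _ - lam * (A i ⬝ᵥ (V⁻¹ *ᵥ u.ofLp)) + _ - _ = _
    ring
  rw [h3]
  calc _ ≤ |e ⬝ᵥ (V⁻¹ *ᵥ u.ofLp)| + |lam * (A i ⬝ᵥ (V⁻¹ *ᵥ u.ofLp))| := abs_sub _ _
    _ ≤ _ := by linarith

end Estimate

/-! ### Deterministic regret analysis -/

section Regret

variable {n d : ℕ} {lam D G C : ℝ} {X : Set (Act d)} {T : ℕ}

lemma log_det_gram_le (hlam : lam = max 1 (D ^ 2)) (hT : 2 ≤ T) {x : ℕ → Act d} {t : ℕ}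
    (ht : t ≤ T + 1) (hx : ∀ s ∈ Finset.Icc 1 T, ‖x s‖ ≤ D / 2) :
    Real.log ((gram lam x t).det / lam ^ d) ≤ d * Real.log T := by
  have hlam1 : 1 ≤ lam := hlam ▸ le_max_left _ _
  have hlamD : D ^ 2 ≤ lam := hlam ▸ le_max_right _ _
  have hlam0 : 0 < lam := by linarith
  have h1 : (gram lam x t).det ≤ (lam + (t - 1 : ℕ) * (D ^ 2 / 4)) ^ d := by
    refine det_gram_le hlam0 x t fun s hs => ?_
    rw [Finset.mem_Ico] at hs
    have h := hx s (Finset.mem_Icc.2 ⟨hs.1, by omega⟩)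
    have h0 := norm_nonneg (x s)
    nlinarith
  have hT2 : (2 : ℝ) ≤ T := by exact_mod_cast hT
  have h2 : ((t - 1 : ℕ) : ℝ) ≤ T := by exact_mod_cast (by omega : t - 1 ≤ T)
  -- The actions have squared norm at most D²/4 ≤ lam/4, so lam + T lam/4 ≤ lam T already for T ≥ 2
  -- and no constant enters the logarithm.
  have h3 : lam + (t - 1 : ℕ) * (D ^ 2 / 4) ≤ lam * T := by
    have : ((t - 1 : ℕ) : ℝ) * (D ^ 2 / 4) ≤ T * (lam / 4) := by gcongr
    nlinarith
  rw [← Real.log_pow]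
  refine Real.log_le_log (div_pos (gram_posDef hlam0 x t).det_pos (by positivity)) ?_
  rw [div_le_iff₀ (by positivity), ← mul_pow, mul_comm (T : ℝ)]
  exact h1.trans (by gcongr)

lemma mem_pessSet_of_play {b : Fin n → ℝ} (hXc : IsClosed X) (hX0 : (0 : Act d) ∈ X)
    (hb0 : ∀ i, 0 ≤ b i) {β : ℕ → ℝ} {xt x : ℕ → Act d} {y : ℕ → Fin n → ℝ} {t : ℕ}
    (hplay : x t = safeScale (pessSet X b lam 0 β x y t) (xt t) • xt t) :
    x t ∈ pessSet X b lam 0 β x y t := by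
  have h : safeScale (pessSet X b lam 0 β x y t) (xt t) • xt t ∈ pessSet X b lam 0 β x y t :=
    (safeScale_mem (isClosed_estSet hXc) (zero_mem_estSet hX0 hb0) (xt t)).2
  rwa [← hplay] at h

/-- The price of playing safely scaled actions. -/
lemma sum_cost_sub_le {b : Fin n → ℝ} {bm : ℝ} (hbm : 0 < bm) (hb : ∀ i, bm ≤ b i)
    (hT : 3 ≤ T) (hX : Convex ℝ X) (hXc : IsClosed X) (hXb : ∀ u ∈ X, ‖u‖ ≤ D / 2)
    (hX0 : (0 : Act d) ∈ X) (hlam : lam = max 1 (D ^ 2)) {β : ℕ → ℝ}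
    (hβ0 : ∀ t ∈ Set.Icc 1 T, 0 ≤ β t) (hβT : ∀ t ∈ Set.Icc 1 T, β t ≤ β T)
    {xt x : ℕ → Act d} {y : ℕ → Fin n → ℝ} {f : ℕ → Act d → ℝ}
    (hf : ∀ t ∈ Set.Icc 1 T, AdmissibleCost X G (f t))
    (hplay : ∀ t ∈ Set.Icc 1 T, x t = safeScale (pessSet X b lam 0 β x y t) (xt t) • xt t)
    (hopt : ∀ t ∈ Set.Icc 1 T, xt t ∈ optSet X b lam 0 β x y t) :
    ∑ t ∈ Finset.Icc 1 T, (f t (x t) - f t (xt t)) ≤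
      4 * (D * G / bm) * β T * √(3 * d * T * Real.log T) := by
  have hlam1 : 1 ≤ lam := hlam ▸ le_max_left _ _
  have hlamD : D ^ 2 ≤ lam := hlam ▸ le_max_right _ _
  have hlam0 : 0 < lam := by linarith
  have hb0 : ∀ i, 0 ≤ b i := fun i => hbm.le.trans (hb i)
  have hD : 0 ≤ D := by have := hXb 0 hX0; rw [norm_zero] at this; linarith
  have h1T : 1 ∈ Set.Icc 1 T := ⟨le_rfl, by omega⟩
  have hG : 0 ≤ G := (hf 1 h1T).nonneg ⟨0, hX0⟩
  have hTT : T ∈ Set.Icc 1 T := ⟨by omega, le_rfl⟩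
  have hβ := hβ0 T hTT
  have hxX : ∀ t ∈ Set.Icc 1 T, x t ∈ X := fun t ht =>
     (mem_pessSet_of_play hXc hX0 hb0 (hplay t ht)).1
  have hxn : ∀ s ∈ Finset.Icc 1 T, ‖x s‖ ≤ D / 2 := fun s hs =>
    hXb _ (hxX s (Finset.mem_Icc.1 hs))
  have hstep : ∀ t ∈ Set.Icc 1 T, f t (x t) - f t (xt t) ≤
      G * (D / 2) * (2 * β T / bm) * √2 * wnorm (gram lam x t)⁻¹ (x t) := by
    intro t ht
    have hτ1 := one_le_phaseStart lam x t
    have hτt := phaseStart_le lam x ht.1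
    have hdet := det_gram_le_phaseStart hlam0 x ht.1
    have hτ : phaseStart lam x t ∈ Set.Icc 1 T := ⟨hτ1, hτt.trans ht.2⟩
    have ho := hopt t ht
    have hp := hplay t ht
    have hγ := safeScale_mem (isClosed_estSet hXc) (zero_mem_estSet hX0 hb0) (xt t) (Y :=
      pessSet X b lam 0 β x y t)
    have hs := one_sub_safeScale_le hX hXc hX0 hbm hb (hβ0 _ hτ) ho
    change 1 - safeScale (pessSet X b lam 0 β x y t) (xt t) ≤ _ * wnorm _
      (safeScale (pessSet X b lam 0 β x y t) (xt t) • xt t) at hs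
    rw [← hp] at hs
    set γ := safeScale (pessSet X b lam 0 β x y t) (xt t)
    set τ := phaseStart lam x t
    have hL := (hf t ht).sub_le hX (hxX t ht) ho.1
    have hn : ‖x t - xt t‖ ≤ (1 - γ) * (D / 2) := by
      have : x t - xt t = -((1 - γ) • xt t) := by rw [hp]; module
      rw [this, norm_neg, norm_smul, Real.norm_of_nonneg (by linarith [hγ.1.2])]
      exact mul_le_mul_of_nonneg_left (hXb _ ho.1) (by linarith [hγ.1.2])
    -- Within a phase det V_t ≤ 2 det V_τ, so the two squared norms differ at most by the factor 2.
    have hw : wnorm (gram lam x τ)⁻¹ (x t) ≤ √2 * wnorm (gram lam x t)⁻¹ (x t) := by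
      refine abs_le_of_sq_le_sq' ?_ (mul_nonneg (Real.sqrt_nonneg _) (wnorm_nonneg _ _)) |>.2
      rw [mul_pow, Real.sq_sqrt zero_le_two, wnorm_inv_sq (gram_posDef hlam0 x τ),
        wnorm_inv_sq (gram_posDef hlam0 x t)]
      have h1 := dotProduct_gram_inv_mul_det_le hlam0 x hτ1 hτt (x t).ofLp
      have h2 := (gram_posDef hlam0 x τ).det_pos
      have h3 := posDef_dotProduct_inv_nonneg (gram_posDef hlam0 x t) (x t).ofLp
      refine le_of_mul_le_mul_right (h1.trans ?_) h2
      rw [mul_comm 2, mul_assoc]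
      exact mul_le_mul_of_nonneg_left hdet h3
    have hwn := wnorm_nonneg (gram lam x t)⁻¹ (x t)
    have hβτ : 2 * β τ / bm ≤ 2 * β T / bm := by
      have := hβT τ hτ
      gcongr
    calc f t (x t) - f t (xt t) ≤ G * ((1 - γ) * (D / 2)) :=
          hL.trans (mul_le_mul_of_nonneg_left hn hG)
      _ = G * (D / 2) * (1 - γ) := by ring
      _ ≤ G * (D / 2) * (2 * β T / bm * (√2 * wnorm (gram lam x t)⁻¹ (x t))) := by
        refine mul_le_mul_of_nonneg_left (hs.trans ?_) (by positivity)
        exact mul_le_mul hβτ hw (wnorm_nonneg _ _) (by positivity)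
      _ = _ := by ring
  -- Cauchy–Schwarz over the rounds, then the elliptical potential lemma.
  have hw : ∑ t ∈ Finset.Icc 1 T, wnorm (gram lam x t)⁻¹ (x t) ≤
      √(T * (2 * (d * Real.log T))) := by
    refine Real.le_sqrt_of_sq_le ?_
    refine sq_sum_le_card_mul_sum_sq.trans ?_
    rw [Nat.card_Icc, Nat.add_sub_cancel]
    gcongr
    have hIcc : Finset.Icc 1 T = Finset.Ico 1 (T + 1) := by ext; simp
    calc ∑ t ∈ Finset.Icc 1 T, wnorm (gram lam x t)⁻¹ (x t) ^ 2
        = ∑ t ∈ Finset.Ico 1 (T + 1), (x t).ofLp ⬝ᵥ ((gram lam x t)⁻¹ *ᵥ (x t).ofLp) := by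
          rw [hIcc]
          exact Finset.sum_congr rfl fun t _ => wnorm_inv_sq (gram_posDef hlam0 x t) _
      _ ≤ 2 * Real.log ((gram lam x (T + 1)).det / lam ^ d) := by
          refine sum_dotProduct_gram_inv_le hlam0 x (by omega) fun s hs => ?_
          rw [← hIcc] at hs
          have h := hxn s hs
          have h0 := norm_nonneg (x s)
          nlinarith
      _ ≤ _ := by
          have := log_det_gram_le (d := d) hlam (by omega) le_rfl hxn
          linarith
  have hlog : 0 ≤ Real.log T := Real.log_natCast_nonneg T
  calc ∑ t ∈ Finset.Icc 1 T, (f t (x t) - f t (xt t))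
      ≤ ∑ t ∈ Finset.Icc 1 T, G * (D / 2) * (2 * β T / bm) * √2 *
          wnorm (gram lam x t)⁻¹ (x t) :=
        Finset.sum_le_sum fun t ht => hstep t (Finset.mem_Icc.1 ht)
    _ = G * (D / 2) * (2 * β T / bm) * √2 *
          ∑ t ∈ Finset.Icc 1 T, wnorm (gram lam x t)⁻¹ (x t) := by rw [Finset.mul_sum]
    _ ≤ G * (D / 2) * (2 * β T / bm) * √2 * √(T * (2 * (d * Real.log T))) := by gcongr
    _ = D * G / bm * β T * √(4 * (d * T * Real.log T)) := by
        rw [mul_assoc _ √2, ← Real.sqrt_mul zero_le_two]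
        ring_nf
    -- The argument yields the constant 2; it is relaxed to the stated 4√3.
    _ ≤ D * G / bm * β T * √(4 ^ 2 * (3 * d * T * Real.log T)) := by
        gcongr
        · norm_num
        · have : (0 : ℝ) ≤ d := by positivity
          linarith
    _ = _ := by
        rw [Real.sqrt_mul (by positivity), Real.sqrt_sq (by norm_num)]
        ring

/-- The expected cost of the subroutine in round `t`. -/
def expCost (alg : OnlineAlgorithm d) (X : Set (Act d)) (b : Fin n → ℝ) (lam : ℝ) (β : ℕ → ℝ)
    (xt x : ℕ → Act d) (y : ℕ → Fin n → ℝ) (f : ℕ → Act d → ℝ) (t : ℕ) : ℝ :=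
  ∫ v, f t v ∂(alg.dist (optSet X b lam 0 β x y t) (t - phaseStart lam x t)
    (fun i => f (phaseStart lam x t + i)) (fun i => xt (phaseStart lam x t + i)))

/-- The action set is fixed during a phase and the subroutine does not know its horizon, so its
guarantee applies to the phase cut off after any round t. -/
lemma sum_phase_le {alg : OnlineAlgorithm d} (hC : HasRegretConstant alg D G T C)
    {b : Fin n → ℝ}
    (hX : Convex ℝ X) (hXc : IsClosed X) (hXb : ∀ u ∈ X, ‖u‖ ≤ D / 2) {β : ℕ → ℝ}
    {xt x : ℕ → Act d} {y : ℕ → Fin n → ℝ} {f : ℕ → Act d → ℝ}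
    (hf : ∀ t ∈ Set.Icc 1 T, AdmissibleCost X G (f t))
    (hopt : ∀ t ∈ Set.Icc 1 T, xt t ∈ optSet X b lam 0 β x y t)
    {u : Act d} (hu : ∀ t ∈ Set.Icc 1 T, u ∈ optSet X b lam 0 β x y t)
    {t : ℕ} (ht : t ∈ Set.Icc 1 T) :
    ∑ s ∈ Finset.Ico (phaseStart lam x t) (t + 1),
      (expCost alg X b lam β xt x y f s - f s u) ≤ C * √(t + 1 - phaseStart lam x t : ℝ) := by
  have hτ1 := one_le_phaseStart lam x t
  have hτt := phaseStart_le lam x ht.1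
  have hps : ∀ s, phaseStart lam x t ≤ s → s ≤ t → phaseStart lam x s = phaseStart lam x t :=
    fun s => phaseStart_eq_of_mem lam x
  generalize phaseStart lam x t = τ at *
  set K := estSet X b 0 (-β τ) (cross x y τ) (gram lam x τ)
  have hK : ∀ s, τ ≤ s → s ≤ t → optSet X b lam 0 β x y s = K := fun s h1 h2 => by
    rw [optSet, hps s h1 h2]
  set m := t + 1 - τ with hm
  have hKX : K ⊆ X := fun v hv => hv.1
  have hmem : ∀ s < m, τ + s ∈ Set.Icc 1 T ∧ τ + s ≤ t := fun s hs =>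
    ⟨⟨by omega, by have := ht.2; omega⟩, by omega⟩
  have huK : u ∈ K := hK τ le_rfl hτt ▸ hu τ ⟨hτ1, hτt.trans ht.2⟩
  have hfK : ∀ s < m, AdmissibleCost X G (f (τ + s)) := fun s hs => hf _ (hmem s hs).1
  have key := hC.2 K ⟨u, huK⟩ (isClosed_estSet hXc) (fun v hv => hXb v hv.1) m
    (by have := ht.2; omega) (fun s => f (τ + s)) (fun s => xt (τ + s))
    (fun s hs => (hfK s hs).mono hKX)
    (fun s hs => by
      rw [← hK (τ + s) (by omega) (hmem s hs).2]
      exact hopt _ (hmem s hs).1)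
  have hbest := bestFixed_sum_le hX hKX hXb m hfK huK
  have hE : ∀ s < m, expCost alg X b lam β xt x y f (τ + s) =
      ∫ v, f (τ + s) v ∂(alg.dist K s (fun i : Fin s => f (τ + i)) (fun i : Fin s => xt (τ + i))) := by
    intro s hs
    -- The histories are indexed by `Fin k`, so τ + s - τ = s has to be substituted in all arguments
    -- at once.
    have aux : ∀ k, k = s → alg.dist K k (fun i : Fin k => f (τ + i)) (fun i : Fin k => xt (τ + i))
        = alg.dist K s (fun i : Fin s => f (τ + i)) (fun i : Fin s => xt (τ + i)) := by
      rintro k rfl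
      rfl
    rw [expCost, hK _ (by omega) (hmem s hs).2, hps _ (by omega) (hmem s hs).2,
      aux _ (by omega)]
  have hsum : ∑ s ∈ Finset.Ico τ (t + 1), (expCost alg X b lam β xt x y f s - f s u) =
      ∑ s ∈ Finset.range m, ∫ v, f (τ + s) v
        ∂(alg.dist K s (fun i : Fin s => f (τ + i)) (fun i : Fin s => xt (τ + i)))
      - ∑ s ∈ Finset.range m, f (τ + s) u := by
    rw [Finset.sum_Ico_eq_sum_range, ← Finset.sum_sub_distrib]
    refine Finset.sum_congr rfl fun s hs => ?_
    rw [hE s (Finset.mem_range.1 hs)]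
  have hcast : (t + 1 - τ : ℝ) = (m : ℕ) := by
    rw [hm, Nat.cast_sub (by omega)]
    push_cast
    ring
  rw [hsum, hcast]
  linarith

/-- One induction step of Cauchy–Schwarz: a sum of a + 1 square roots is at most the square root of
a + 1 times the total. -/
lemma sqrt_mul_add_sqrt_le {a b c : ℝ} (ha : 0 ≤ a) (hb : 0 ≤ b) (hc : 0 ≤ c) :
    √(a * b) + √c ≤ √((a + 1) * (b + c)) := by
  refine Real.le_sqrt_of_sq_le ?_
  rw [add_sq, Real.sq_sqrt (mul_nonneg ha hb), Real.sq_sqrt hc]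
  have h : 2 * √(a * b) * √c ≤ a * c + b := by
    rw [mul_assoc, ← Real.sqrt_mul (mul_nonneg ha hb), mul_right_comm,
      Real.sqrt_mul (mul_nonneg ha hc)]
    have := two_mul_le_add_sq √(a * c) √b
    rw [Real.sq_sqrt (mul_nonneg ha hc), Real.sq_sqrt hb] at this
    linarith
  nlinarith

/-- The regret of the restarted subroutine. -/
lemma sum_expCost_sub_le {alg : OnlineAlgorithm d} (hC : HasRegretConstant alg D G T C)
    {b : Fin n → ℝ} (hd : 2 ≤ d) (hT : 3 ≤ T)
    (hX : Convex ℝ X) (hXc : IsClosed X) (hXb : ∀ u ∈ X, ‖u‖ ≤ D / 2) (hlam : lam = max 1 (D ^ 2)) {β : ℕ → ℝ}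
    {xt x : ℕ → Act d} {y : ℕ → Fin n → ℝ} {f : ℕ → Act d → ℝ}
    (hf : ∀ t ∈ Set.Icc 1 T, AdmissibleCost X G (f t))
    (hxn : ∀ s ∈ Finset.Icc 1 T, ‖x s‖ ≤ D / 2)
    (hopt : ∀ t ∈ Set.Icc 1 T, xt t ∈ optSet X b lam 0 β x y t)
    {u : Act d} (hu : ∀ t ∈ Set.Icc 1 T, u ∈ optSet X b lam 0 β x y t) :
    ∑ t ∈ Finset.Icc 1 T, (expCost alg X b lam β xt x y f t - f t u) ≤
      C * √(4 * d * T * Real.log T) := by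
  have hlam1 : 1 ≤ lam := hlam ▸ le_max_left _ _
  have hlam0 : 0 < lam := by linarith
  set E : ℕ → ℝ := fun t => expCost alg X b lam β xt x y f t - f t u
  have hphase : ∀ t ∈ Set.Icc 1 T, ∑ s ∈ Finset.Ico (phaseStart lam x t) (t + 1), E s ≤
      C * √(t + 1 - phaseStart lam x t : ℝ) := fun t ht =>
    sum_phase_le hC hX hXc hXb hf hopt hu ht
  have hcomb : ∀ t ∈ Set.Icc 1 T, ∀ N : ℕ, ∑ s ∈ Finset.Ico 1 (phaseStart lam x t), E s ≤
      C * √(N * (phaseStart lam x t - 1 : ℝ)) →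
      ∑ s ∈ Finset.Ico 1 (t + 1), E s ≤ C * √((N + 1 : ℝ) * t) := by
    intro t ht N hN
    have hτ1 := one_le_phaseStart lam x t
    have hτt := phaseStart_le lam x ht.1
    have h := hphase t ht
    have hτ1' : (1 : ℝ) ≤ phaseStart lam x t := by exact_mod_cast hτ1
    have hτt' : (phaseStart lam x t : ℝ) ≤ t := by exact_mod_cast hτt
    rw [← Finset.sum_Ico_consecutive E hτ1 (by omega)]
    have h2 := sqrt_mul_add_sqrt_le (a := N) (b := phaseStart lam x t - 1)
      (c := t + 1 - phaseStart lam x t) (by positivity) (by linarith) (by linarith)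
    have h3 : (phaseStart lam x t - 1 + (t + 1 - phaseStart lam x t) : ℝ) = t := by ring
    rw [h3] at h2
    have h4 := mul_le_mul_of_nonneg_left h2 hC.1.le
    linarith
  -- N counts the completed phases. Each new phase doubles the determinant, which starts at lam ^ d.
  have hN : ∀ t, 1 ≤ t → t ≤ T → ∃ N : ℕ, 2 ^ N * lam ^ d ≤ (gram lam x (phaseStart lam x t)).det ∧
      ∑ s ∈ Finset.Ico 1 (phaseStart lam x t), E s ≤
        C * √(N * (phaseStart lam x t - 1 : ℝ)) := by
    intro t ht
    induction t, ht using Nat.le_induction with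
    | base =>
      intro _
      exact ⟨0, by simp [phaseStart_one, gram_one], by simp [phaseStart_one]⟩
    | succ t ht ih =>
      intro htT
      obtain ⟨N, h1, h2⟩ := ih (by omega)
      rw [phaseStart]
      split_ifs with h
      · exact ⟨N, h1, h2⟩
      · refine ⟨N + 1, ?_, ?_⟩
        · rw [pow_succ]
          linarith
        · have := hcomb t ⟨ht, by omega⟩ N h2
          push_cast
          simpa using this
  obtain ⟨N, h1, h2⟩ := hN T (by omega) le_rfl
  have h3 := hcomb T ⟨by omega, le_rfl⟩ N h2
  have hIcc : Finset.Icc 1 T = Finset.Ico 1 (T + 1) := by ext; simp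
  rw [hIcc]
  refine h3.trans (mul_le_mul_of_nonneg_left (Real.sqrt_le_sqrt ?_) hC.1.le)
  have hlogdet := log_det_gram_le (d := d) (lam := lam) (x := x) hlam (T := T) (by omega)
    ((phaseStart_le lam x (by omega : 1 ≤ T)).trans (by omega)) hxn
  have hlogN : N * Real.log 2 ≤ d * Real.log T := by
    refine le_trans ?_ hlogdet
    rw [← Real.log_pow]
    exact Real.log_le_log (by positivity) ((le_div_iff₀ (by positivity)).2 h1)
  have hlogT : 1 ≤ Real.log T := by
    rw [Real.le_log_iff_exp_le (by positivity)]
    have : (3 : ℝ) ≤ T := by exact_mod_cast hT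
    linarith [Real.exp_one_lt_d9]
  have hd2 : (2 : ℝ) ≤ d := by exact_mod_cast hd
  have hl2 := Real.log_two_gt_d9
  have hN0 : (0 : ℝ) ≤ N := by positivity
  have hdl : 2 ≤ d * Real.log T := by nlinarith
  -- N is at most d log T / log 2, and the extra 1 for the current phase is absorbed because d ≥ 2
  -- and log T ≥ 1.
  have : (N : ℝ) + 1 ≤ 4 * (d * Real.log T) := by nlinarith
  calc (N + 1 : ℝ) * T ≤ 4 * (d * Real.log T) * T := by gcongr
    _ = _ := by ring

/-- Regret and safety of OSOCO on the event that the confidence sets are valid and the sampled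
costs are close to their conditional expectations. -/
theorem regret_le_and_safe {alg : OnlineAlgorithm d} (hC : HasRegretConstant alg D G T C)
    {A : Matrix (Fin n) (Fin d) ℝ}
    {b : Fin n → ℝ} {bm : ℝ} (hbm : 0 < bm) (hb : ∀ i, bm ≤ b i) (hd : 2 ≤ d) (hT : 3 ≤ T)
    (hX : Convex ℝ X) (hXc : IsClosed X) (hXb : ∀ u ∈ X, ‖u‖ ≤ D / 2)
    (hX0 : (0 : Act d) ∈ X) (hlam : lam = max 1 (D ^ 2)) {β : ℕ → ℝ}
    (hβ0 : ∀ t ∈ Set.Icc 1 T, 0 ≤ β t) (hβT : ∀ t ∈ Set.Icc 1 T, β t ≤ β T)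
    {xt x : ℕ → Act d} {y : ℕ → Fin n → ℝ} {f : ℕ → Act d → ℝ}
    (hf : ∀ t ∈ Set.Icc 1 T, AdmissibleCost X G (f t))
    (hplay : ∀ t ∈ Set.Icc 1 T, x t = safeScale (pessSet X b lam 0 β x y t) (xt t) • xt t)
    (hopt : ∀ t ∈ Set.Icc 1 T, xt t ∈ optSet X b lam 0 β x y t)
    (hest : ∀ t ∈ Set.Icc 1 T, ∀ (u : Act d) (i : Fin n),
      |((cross x y t * (gram lam x t)⁻¹) *ᵥ u.ofLp) i - (A *ᵥ u.ofLp) i| ≤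
        β t * wnorm (gram lam x t)⁻¹ u)
    {R : ℝ} (hR : ∑ t ∈ Finset.Icc 1 T, (f t (xt t) - expCost alg X b lam β xt x y f t) ≤ R) :
    regret X A b T f x ≤ 4 * (D * G / bm) * β T * √(3 * d * T * Real.log T)
        + C * √(4 * d * T * Real.log T) + R ∧
      ∀ t ∈ Set.Icc 1 T, A *ᵥ (x t).ofLp ≤ b := by
  have hb0 : ∀ i, 0 ≤ b i := fun i => hbm.le.trans (hb i)
  have hxp : ∀ t ∈ Set.Icc 1 T, x t ∈ pessSet X b lam 0 β x y t := fun t ht =>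
    mem_pessSet_of_play hXc hX0 hb0 (hplay t ht)
  have hτ : ∀ t ∈ Set.Icc 1 T, phaseStart lam x t ∈ Set.Icc 1 T := fun t ht =>
    ⟨one_le_phaseStart lam x t, (phaseStart_le lam x ht.1).trans ht.2⟩
  refine ⟨?_, fun t ht i => ?_⟩
  · have h1 := sum_cost_sub_le hbm hb hT hX hXc hXb hX0 hlam hβ0 hβT hf hplay hopt
    rw [regret, sub_le_iff_le_add, ← sub_le_iff_le_add']
    refine le_csInf ⟨_, 0, ⟨hX0, fun i => by simpa using hb0 i⟩, rfl⟩ ?_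
    rintro _ ⟨u, hu, rfl⟩
    -- Validity of the estimate at the phase start makes feasible points optimistic; the opposite
    -- inequality makes pessimistic points safe.
    have huo : ∀ t ∈ Set.Icc 1 T, u ∈ optSet X b lam 0 β x y t := fun t ht =>
      ⟨hu.1, fun i => by
        have h := (abs_le.1 (hest _ (hτ t ht) u i)).2
        have h' := hu.2 i
        linarith⟩
    have h2 := sum_expCost_sub_le hC hd hT hX hXc hXb hlam hf
      (fun s hs => hXb _ (hxp s (Finset.mem_Icc.1 hs)).1) hopt huo
    simp only [Finset.sum_sub_distrib] at h1 h2 hR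
    linarith
  · have h := (abs_le.1 (hest _ (hτ t ht) (x t) i)).1
    have h' := (hxp t ht).2 i
    linarith

end Regret

/-! ### Conditional distributions -/

section CondLaw

variable {Ω : Type*} {m mΩ : MeasurableSpace Ω} {μ : Measure Ω}
  {E : Type*} [mE : MeasurableSpace E]

/-- `κ` is a regular conditional distribution of `Y` given the σ-algebra `m`. -/
structure IsCondLaw (μ : Measure Ω) (m : MeasurableSpace Ω) (Y : Ω → E) (κ : Ω → Measure E) :
    Prop where
  prob : ∀ ω, IsProbabilityMeasure (κ ω)
  measurable_integral : ∀ φ : Ω × E → ℝ, Measurable[m.prod mE] φ →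
    Measurable[m] fun ω => ∫ y, φ (ω, y) ∂κ ω
  lintegral_eq : ∀ φ : Ω × E → ENNReal, Measurable[m.prod mE] φ →
    ∫⁻ ω, φ (ω, Y ω) ∂μ = ∫⁻ ω, ∫⁻ y, φ (ω, y) ∂κ ω ∂μ
  integrable : ∀ h : E → ℝ, Measurable h → Integrable (fun ω => h (Y ω)) μ →
    ∀ᵐ ω ∂μ, Integrable h (κ ω)
  condExp_eq : ∀ h : E → ℝ, Measurable h → Integrable (fun ω => h (Y ω)) μ →
    μ[fun ω => h (Y ω) | m] =ᵐ[μ] fun ω => ∫ y, h y ∂κ ω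

lemma lintegral_condDistrib {β : Type*} [MeasurableSpace β] [IsProbabilityMeasure μ]
    [StandardBorelSpace E] [Nonempty E] {X : Ω → β} {Y : Ω → E} (hX : Measurable X)
    (hY : Measurable Y) {φ : β × E → ENNReal} (hφ : Measurable φ) :
    ∫⁻ ω, φ (X ω, Y ω) ∂μ = ∫⁻ ω, ∫⁻ y, φ (X ω, y) ∂condDistrib Y X μ (X ω) ∂μ := by
  rw [← lintegral_map hφ (hX.prodMk hY), ← compProd_map_condDistrib hY.aemeasurable,
    Measure.lintegral_compProd hφ, lintegral_map hφ.lintegral_kernel_prod_right' hX]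

lemma ae_integrable_condDistrib {β : Type*} [MeasurableSpace β] [IsProbabilityMeasure μ]
    [StandardBorelSpace E] [Nonempty E] {X : Ω → β} {Y : Ω → E} (hX : Measurable X)
    (hY : Measurable Y) {h : E → ℝ} (hh : Measurable h) (hint : Integrable (fun ω => h (Y ω)) μ) :
    ∀ᵐ ω ∂μ, Integrable h (condDistrib Y X μ (X ω)) := by
  have h1 : Integrable (fun p : β × E => h p.2) (μ.map fun a => (X a, Y a)) :=
    (integrable_map_measure (hh.comp measurable_snd).aestronglyMeasurable
      (hX.prodMk hY).aemeasurable).2 hint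
  exact h1.condDistrib_ae hX.aemeasurable hY.aemeasurable

/-- The kernel is the conditional distribution of Y given the identity map from Ω with its full
σ-algebra to Ω with m. -/
lemma exists_isCondLaw [IsProbabilityMeasure μ] (hm : m ≤ mΩ) [StandardBorelSpace E] [Nonempty E]
    {Y : Ω → E} (hY : Measurable Y) : ∃ κ, IsCondLaw μ m Y κ := by
  have hid : @Measurable Ω Ω mΩ m id := measurable_id'' hm
  refine ⟨fun ω => @condDistrib Ω Ω E _ _ _ mΩ m Y id μ _ ω, fun ω => ?_, fun φ hφ => ?_,
    fun φ hφ => ?_, fun h hh hint => ?_, fun h hh hint => ?_⟩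
  · infer_instance
  · exact (@StronglyMeasurable.integral_kernel_prod_right' Ω E m _ _ ℝ _ _ _ φ
      hφ.stronglyMeasurable).measurable
  · exact @lintegral_condDistrib Ω mΩ μ E _ Ω m _ _ _ id Y hid hY φ hφ
  · exact @ae_integrable_condDistrib Ω mΩ μ E _ Ω m _ _ _ id Y hid hY h hh hint
  · have h1 := @condExp_ae_eq_integral_condDistrib Ω Ω E ℝ _ _ _ _ mΩ μ _ id Y m _ _ hid
      hY.aemeasurable h hh.stronglyMeasurable hint
    rwa [MeasurableSpace.comap_id] at h1

/-- The one-step supermartingale inequality shared by both concentration arguments: W is the weight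
known from the past, r a factor of conditional mean at most 1. -/
lemma IsCondLaw.lintegral_mul_le {Y : Ω → E} {κ : Ω → Measure E}
    (hκ : IsCondLaw μ m Y κ) {W : Ω → ENNReal} (hW : Measurable[m] W) {r : Ω × E → ENNReal}
    (hr : Measurable[m.prod mE] r) (hle : ∀ᵐ ω ∂μ, ∫⁻ y, r (ω, y) ∂κ ω ≤ 1) :
    ∫⁻ ω, W ω * r (ω, Y ω) ∂μ ≤ ∫⁻ ω, W ω ∂μ := by
  have hW' : Measurable[m.prod mE] fun p : Ω × E => W p.1 := hW.comp (@measurable_fst Ω E m mE)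
  have hr' : ∀ ω, Measurable fun y => r (ω, y) := fun ω =>
    hr.comp (@measurable_prodMk_left Ω E m mE ω)
  rw [hκ.lintegral_eq (fun p => W p.1 * r p) (hW'.mul hr)]
  refine lintegral_mono_ae ?_
  filter_upwards [hle] with ω hω
  rw [lintegral_const_mul _ (hr' ω)]
  exact mul_le_of_le_one_right' hω

lemma exists_countable_isPiSystem [MeasurableSpace.CountablyGenerated E] :
    ∃ P : Set (Set E), P.Countable ∧ IsPiSystem P ∧ mE = MeasurableSpace.generateFrom P := by
  set C := MeasurableSpace.countableGeneratingSet E with hC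
  have hCc : C.Countable := MeasurableSpace.countable_countableGeneratingSet
  refine ⟨Set.sInter '' {F | F.Finite ∧ F ⊆ C}, (Set.countable_ofPred_finite_subset hCc).image _,
    ?_, ?_⟩
  · rintro _ ⟨F, hF, rfl⟩ _ ⟨F', hF', rfl⟩ -
    exact ⟨F ∪ F', ⟨hF.1.union hF'.1, Set.union_subset hF.2 hF'.2⟩, Set.sInter_union _ _⟩
  · apply le_antisymm
    · conv_lhs => rw [← MeasurableSpace.generateFrom_countableGeneratingSet (α := E)]
      refine MeasurableSpace.generateFrom_mono fun s hs => ?_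
      exact ⟨{s}, ⟨Set.finite_singleton s, Set.singleton_subset_iff.2 hs⟩, Set.sInter_singleton s⟩
    · refine MeasurableSpace.generateFrom_le ?_
      rintro _ ⟨F, hF, rfl⟩
      exact MeasurableSet.sInter hF.1.countable fun s hs =>
        MeasurableSpace.measurableSet_countableGeneratingSet (hF.2 hs)

/-- The exceptional null set in `h` depends on B. A countable π-system generating the σ-algebra
leaves only countably many of them, and p need not be measurable in ω. -/
lemma IsCondLaw.ae_eq_of_condExp_indicator [IsProbabilityMeasure μ]
    [MeasurableSpace.CountablyGenerated E]
    {Y : Ω → E} (hY : Measurable Y) {κ : Ω → Measure E} (hκ : IsCondLaw μ m Y κ)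
    {p : Ω → Measure E} (hp : ∀ ω, IsProbabilityMeasure (p ω))
    (h : ∀ B, MeasurableSet B →
      μ[(Y ⁻¹' B).indicator (fun _ => (1 : ℝ)) | m] =ᵐ[μ] fun ω => (p ω).real B) :
    ∀ᵐ ω ∂μ, p ω = κ ω := by
  obtain ⟨P, hPc, hPpi, hPgen⟩ := exists_countable_isPiSystem (E := E)
  have hB : ∀ B ∈ P, ∀ᵐ ω ∂μ, p ω B = κ ω B := by
    intro B hBP
    have hBm : MeasurableSet B := by
      rw [hPgen]
      exact MeasurableSpace.measurableSet_generateFrom hBP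
    have h1 : Integrable (fun ω => B.indicator (fun _ => (1 : ℝ)) (Y ω)) μ :=
      (integrable_const (1 : ℝ)).indicator (hY hBm)
    have h2 := hκ.condExp_eq _ (measurable_const.indicator hBm) h1
    filter_upwards [h B hBm, h2] with ω hω1 hω2
    have := hκ.prob ω
    have := hp ω
    have h3 : (p ω).real B = (κ ω).real B := by
      rw [← hω1]
      refine hω2.trans ?_
      rw [integral_indicator hBm]
      simp
    rw [measureReal_def, measureReal_def] at h3
    exact (ENNReal.toReal_eq_toReal_iff' (measure_ne_top _ _) (measure_ne_top _ _)).1 h3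
  filter_upwards [(ae_ball_iff hPc).2 hB] with ω hω
  have := hκ.prob ω
  have := hp ω
  exact ext_of_generate_finite P hPgen hPpi hω (by simp)

end CondLaw

/-! ### A maximal inequality for nonnegative supermartingales -/

section Ville

variable {Ω : Type*} {mΩ : MeasurableSpace Ω} {μ : Measure Ω}

lemma mul_measure_exists_le_le {T : ℕ} {m : ℕ → MeasurableSpace Ω} {M : ℕ → Ω → ENNReal}
    (hm : ∀ t ∈ Set.Icc 1 T, m t ≤ mΩ)
    (hM : ∀ s t, 1 ≤ s → s ≤ t → t ≤ T → Measurable[m t] (M s))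
    (hsuper : ∀ t, 1 ≤ t → t < T → ∀ B, MeasurableSet[m t] B →
      ∫⁻ ω in B, M (t + 1) ω ∂μ ≤ ∫⁻ ω in B, M t ω ∂μ) (c : ENNReal) :
    c * μ {ω | ∃ t ∈ Set.Icc 1 T, c ≤ M t ω} ≤ ∫⁻ ω, M 1 ω ∂μ := by
  set N : ℕ → Set Ω := fun t => {ω | ∀ s, 1 ≤ s → s ≤ t → M s ω < c} with hN
  have hNm : ∀ t, t ≤ T → 1 ≤ t → MeasurableSet[m t] (N t) := by
    intro t ht h1
    have : N t = ⋂ s ∈ Set.Icc 1 t, {ω | M s ω < c} := by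
      ext ω
      simp [hN]
    rw [this]
    refine MeasurableSet.biInter (Set.to_countable _) fun s hs => ?_
    exact measurableSet_lt (hM s t hs.1 hs.2 ht) measurable_const
  have hstep : ∀ t, 1 ≤ t → t ≤ T → ∀ B : Set Ω, MeasurableSet B →
      ∫⁻ ω in B ∩ {ω | M t ω < c}, M t ω ∂μ + c * μ (B \ {ω | M t ω < c}) ≤
        ∫⁻ ω in B, M t ω ∂μ := by
    intro t h1 ht B hB
    have hlt : MeasurableSet {ω | M t ω < c} :=
      measurableSet_lt ((hM t t h1 le_rfl ht).mono (hm t ⟨h1, ht⟩) le_rfl) measurable_const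
    rw [← lintegral_inter_add_sdiff _ B hlt]
    gcongr
    refine le_trans ?_ (setLIntegral_mono' (hB.diff hlt) (f := fun _ => c) fun ω hω =>
      not_lt.1 hω.2)
    simp
  -- This is the expectation of M stopped at its first passage above c, with the stopped value
  -- lowered to c; it does not increase in t.
  have hind : ∀ t, 1 ≤ t → t ≤ T →
      ∫⁻ ω in N t, M t ω ∂μ + c * μ (N t)ᶜ ≤ ∫⁻ ω, M 1 ω ∂μ := by
    intro t h1
    induction t, h1 using Nat.le_induction with
    | base =>
      intro h
      have h2 := hstep 1 le_rfl h Set.univ MeasurableSet.univ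
      have h3 : N 1 = {ω | M 1 ω < c} := by
        ext ω
        exact ⟨fun h => h 1 le_rfl le_rfl, fun h s hs1 hs2 => by
          rwa [le_antisymm hs2 hs1]⟩
      rwa [Set.univ_inter, ← Set.compl_eq_univ_sdiff, ← h3, setLIntegral_univ] at h2
    | succ t h1 ih =>
      intro ht
      have ht' : t ≤ T := by omega
      have hNt := hNm t ht' h1
      have h2 := hstep (t + 1) (by omega) ht (N t) (hm t ⟨h1, ht'⟩ _ hNt)
      have h3 : N (t + 1) = N t ∩ {ω | M (t + 1) ω < c} := by
        ext ω
        refine ⟨fun h => ⟨fun s h1 h2 => h s h1 (by omega), h _ (by omega) le_rfl⟩,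
          fun h s hs1 hs2 => ?_⟩
        rcases hs2.eq_or_lt with rfl | hs2
        · exact h.2
        · exact h.1 s hs1 (by omega)
      have h4 : (N (t + 1))ᶜ ⊆ (N t \ {ω | M (t + 1) ω < c}) ∪ (N t)ᶜ := by
        rw [h3]
        intro ω hω
        by_cases h : ω ∈ N t
        · exact Or.inl ⟨h, fun h' => hω ⟨h, h'⟩⟩
        · exact Or.inr h
      calc ∫⁻ ω in N (t + 1), M (t + 1) ω ∂μ + c * μ (N (t + 1))ᶜ
          ≤ ∫⁻ ω in N (t + 1), M (t + 1) ω ∂μ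
            + c * (μ (N t \ {ω | M (t + 1) ω < c}) + μ (N t)ᶜ) := by
            gcongr
            exact (measure_mono h4).trans (measure_union_le _ _)
        _ ≤ ∫⁻ ω in N t, M (t + 1) ω ∂μ + c * μ (N t)ᶜ := by
            rw [mul_add, ← add_assoc, h3]
            gcongr
        _ ≤ ∫⁻ ω in N t, M t ω ∂μ + c * μ (N t)ᶜ := by
            gcongr 1
            exact hsuper t h1 (by omega) _ hNt
        _ ≤ _ := ih ht'
  rcases Nat.eq_zero_or_pos T with rfl | hT
  · have : {ω | ∃ t ∈ Set.Icc 1 0, c ≤ M t ω} = ∅ := by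
      ext ω
      simp only [Set.mem_ofPred_eq, Set.mem_empty_iff_false, iff_false]
      rintro ⟨t, ht, -⟩
      have := ht.1.trans ht.2
      omega
    rw [this]
    simp
  · refine le_trans ?_ ((le_add_left le_rfl).trans (hind T hT le_rfl))
    gcongr
    rintro ω ⟨t, ht, hc⟩ hω
    exact not_lt.2 hc (hω t ht.1 ht.2)

end Ville

/-! ### Gaussian mixtures of subgaussian exponentials -/

section Mixture

/-- The average of `exp (g e - g² / 2)` over `g ∼ N(s, w)`. -/
def mixture (s w e : ℝ) : ℝ :=
  (√(1 + w))⁻¹ * Real.exp ((2 * e * s + e ^ 2 * w - s ^ 2) / (2 * (1 + w)))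

lemma mixture_nonneg (s w e : ℝ) : 0 ≤ mixture s w e := by
  unfold mixture
  positivity

/-- Completing the square: Gaussian density times exponential is the closed form times the density
of N((s + ew)/(1 + w), w/(1 + w)). The case w = 0 is a Dirac mass. -/
lemma ofReal_mixture {w : ℝ} (hw : 0 ≤ w) (s e : ℝ) :
    ENNReal.ofReal (mixture s w e) =
      ∫⁻ g, ENNReal.ofReal (Real.exp (g * e - g ^ 2 / 2)) ∂gaussianReal s w.toNNReal := by
  rcases hw.eq_or_lt with rfl | hw
  · rw [Real.toNNReal_zero, gaussianReal_zero_var, lintegral_dirac, mixture]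
    congr 1
    rw [add_zero, Real.sqrt_one, inv_one, one_mul]
    congr 1
    ring
  have hw0 : w.toNNReal ≠ 0 := by simpa using hw
  have hw' : ((w / (1 + w)).toNNReal : NNReal) ≠ 0 := by
    have : 0 < w / (1 + w) := by positivity
    simpa using this
  have hc1 : ((w.toNNReal : NNReal) : ℝ) = w := Real.coe_toNNReal _ hw.le
  have hc2 : (((w / (1 + w)).toNNReal : NNReal) : ℝ) = w / (1 + w) :=
    Real.coe_toNNReal _ (by positivity)
  have key : ∀ g : ℝ, gaussianPDF s w.toNNReal g * ENNReal.ofReal (Real.exp (g * e - g ^ 2 / 2)) =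
      ENNReal.ofReal (mixture s w e) *
        gaussianPDF ((s + e * w) / (1 + w)) (w / (1 + w)).toNNReal g := by
    intro g
    rw [gaussianPDF, gaussianPDF, ← ENNReal.ofReal_mul (gaussianPDFReal_nonneg _ _ _),
      ← ENNReal.ofReal_mul (mixture_nonneg _ _ _), gaussianPDFReal, gaussianPDFReal, hc1, hc2,
      mixture]
    congr 1
    have h1 : √(2 * Real.pi * (w / (1 + w))) = √(2 * Real.pi * w) / √(1 + w) := by
      rw [← mul_div_assoc, Real.sqrt_div' _ (by positivity)]
    have h2 : √(1 + w) ≠ 0 := by positivity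
    have h3 : √(2 * Real.pi * w) ≠ 0 := by positivity
    rw [h1, inv_div, mul_assoc, ← Real.exp_add]
    have h4 : (√(1 + w))⁻¹ * Real.exp ((2 * e * s + e ^ 2 * w - s ^ 2) / (2 * (1 + w))) *
        (√(1 + w) / √(2 * Real.pi * w) *
          Real.exp (-(g - (s + e * w) / (1 + w)) ^ 2 / (2 * (w / (1 + w))))) =
        (√(2 * Real.pi * w))⁻¹ * (Real.exp ((2 * e * s + e ^ 2 * w - s ^ 2) / (2 * (1 + w))) *
          Real.exp (-(g - (s + e * w) / (1 + w)) ^ 2 / (2 * (w / (1 + w))))) := by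
      field_simp
    rw [h4, ← Real.exp_add]
    congr 2
    field_simp
    ring
  rw [gaussianReal_of_var_ne_zero s hw0,
    lintegral_withDensity_eq_lintegral_mul _ (measurable_gaussianPDF _ _) (by fun_prop)]
  simp only [Pi.mul_apply, key]
  rw [lintegral_const_mul _ (measurable_gaussianPDF _ _), lintegral_gaussianPDF_eq_one _ hw',
    mul_one]

/-- For fixed g the subgaussian bound gives mean at most 1; Tonelli then averages over g. -/
lemma lintegral_mixture_le_one {κ : Measure ℝ} [IsProbabilityMeasure κ]
    (hκ : ∀ l : ℝ, ∫⁻ y, ENNReal.ofReal (Real.exp (l * y)) ∂κ ≤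
      ENNReal.ofReal (Real.exp (l ^ 2 / 2))) {w : ℝ} (hw : 0 ≤ w) (s : ℝ) :
    ∫⁻ e, ENNReal.ofReal (mixture s w e) ∂κ ≤ 1 := by
  simp_rw [ofReal_mixture hw]
  rw [lintegral_lintegral_swap (by fun_prop)]
  refine (lintegral_mono (g := fun _ => 1) fun g => ?_).trans (by simp)
  have : ∀ y : ℝ, ENNReal.ofReal (Real.exp (g * y - g ^ 2 / 2)) =
      ENNReal.ofReal (Real.exp (-(g ^ 2 / 2))) * ENNReal.ofReal (Real.exp (g * y)) := fun y => by
    rw [← ENNReal.ofReal_mul (Real.exp_pos _).le, ← Real.exp_add]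
    congr 2
    ring
  simp_rw [this]
  rw [lintegral_const_mul _ (by fun_prop)]
  refine (mul_le_mul_right (hκ g) _).trans ?_
  rw [← ENNReal.ofReal_mul (Real.exp_pos _).le, ← Real.exp_add]
  simp

lemma measurable_mixture : Measurable fun p : ℝ × ℝ × ℝ => mixture p.1 p.2.1 p.2.2 := by
  unfold mixture
  fun_prop

end Mixture

/-! ### Measurability of the quantities computed by OSOCO -/

section Measurability

variable {α : Type*} {mα : MeasurableSpace α} {n d : ℕ}

lemma measurable_matrix_det {V : α → Matrix (Fin d) (Fin d) ℝ}
    (hV : ∀ i j, Measurable fun a => V a i j) : Measurable fun a => (V a).det := by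
  simp only [Matrix.det_apply']
  exact Finset.measurable_sum _ fun σ _ => measurable_const.mul
    (Finset.measurable_prod _ fun i _ => hV _ _)

lemma measurable_matrix_inv {V : α → Matrix (Fin d) (Fin d) ℝ}
    (hV : ∀ i j, Measurable fun a => V a i j) (i j : Fin d) :
    Measurable fun a => (V a)⁻¹ i j := by
  simp only [Matrix.inv_def, Ring.inverse_eq_inv', Matrix.smul_apply, smul_eq_mul, adjugate_apply]
  refine (measurable_matrix_det hV).inv.mul (measurable_matrix_det fun k l => ?_)
  simp only [updateRow_apply]
  split_ifs
  exacts [measurable_const, hV k l]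

lemma measurable_matrix_mulVec {k : ℕ} {W : α → Matrix (Fin k) (Fin d) ℝ} {v : α → Fin d → ℝ}
    (hW : ∀ i j, Measurable fun a => W a i j) (hv : ∀ j, Measurable fun a => v a j) (i : Fin k) :
    Measurable fun a => (W a *ᵥ v a) i := by
  simp only [mulVec, dotProduct]
  exact Finset.measurable_sum _ fun j _ => (hW i j).mul (hv j)

lemma measurable_dotProduct {u v : α → Fin d → ℝ} (hu : ∀ j, Measurable fun a => u a j)
    (hv : ∀ j, Measurable fun a => v a j) : Measurable fun a => u a ⬝ᵥ v a := by
  simp only [dotProduct]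
  exact Finset.measurable_sum _ fun j _ => (hu j).mul (hv j)

lemma measurable_coord {v : α → Act d} (hv : Measurable v) (j : Fin d) :
    Measurable fun a => (v a).ofLp j :=
  (by fun_prop : Measurable fun u : Act d => u.ofLp j).comp hv

lemma measurable_gram {x : ℕ → α → Act d} (lam : ℝ) {t : ℕ}
    (hx : ∀ s ∈ Finset.Ico 1 t, Measurable (x s)) (i j : Fin d) :
    Measurable fun a => gram lam (fun s => x s a) t i j := by
  simp only [gram, Matrix.add_apply, Matrix.sum_apply, vecMulVec_apply]
  exact measurable_const.add <| Finset.measurable_sum _ fun s hs =>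
    (measurable_coord (hx s hs) i).mul (measurable_coord (hx s hs) j)

lemma measurable_noiseSum {x : ℕ → α → Act d} {e : ℕ → α → ℝ} {t : ℕ}
    (hx : ∀ s ∈ Finset.Ico 1 t, Measurable (x s)) (he : ∀ s ∈ Finset.Ico 1 t, Measurable (e s))
    (j : Fin d) : Measurable fun a => noiseSum (fun s => x s a) (fun s => e s a) t j := by
  simp only [noiseSum, Finset.sum_apply, Pi.smul_apply, smul_eq_mul]
  exact Finset.measurable_sum _ fun s hs => (he s hs).mul (measurable_coord (hx s hs) j)

end Measurability

/-! ### Self-normalized concentration -/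

section SelfNormalized

variable {d : ℕ}

/-- The self-normalized exponential process `(det V_t / lam^d)^{-1/2} exp (‖S_t‖²_{V_t⁻¹} / 2)`. -/
def selfNormalized (lam : ℝ) (x : ℕ → Act d) (e : ℕ → ℝ) (t : ℕ) : ℝ :=
  √(lam ^ d / (gram lam x t).det) *
    Real.exp ((noiseSum x e t ⬝ᵥ ((gram lam x t)⁻¹ *ᵥ noiseSum x e t)) / 2)

lemma selfNormalized_nonneg (lam : ℝ) (x : ℕ → Act d) (e : ℕ → ℝ) (t : ℕ) :
    0 ≤ selfNormalized lam x e t := by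
  unfold selfNormalized
  positivity

lemma selfNormalized_one {lam : ℝ} (hlam : 0 < lam) (x : ℕ → Act d) (e : ℕ → ℝ) :
    selfNormalized lam x e 1 = 1 := by
  simp [selfNormalized, noiseSum, gram_one, hlam.ne']

/-- The rank-one formulas for det and inverse make the ratio of consecutive terms exactly a mixture,
so a Gaussian in one dimension per step replaces the usual one in dimension d. -/
lemma selfNormalized_succ {lam : ℝ} (hlam : 0 < lam) (x : ℕ → Act d) (e : ℕ → ℝ) {t : ℕ}
    (ht : 1 ≤ t) :
    selfNormalized lam x e (t + 1) = selfNormalized lam x e t *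
      mixture ((x t).ofLp ⬝ᵥ ((gram lam x t)⁻¹ *ᵥ noiseSum x e t))
        ((x t).ofLp ⬝ᵥ ((gram lam x t)⁻¹ *ᵥ (x t).ofLp)) (e t) := by
  have hV := gram_posDef hlam x t
  rw [selfNormalized, selfNormalized, mixture, det_gram_succ hlam x ht, gram_succ lam x ht,
    noiseSum_succ x e ht, dotProduct_inv_add_vecMulVec_self hV]
  simp only [mulVec_add, mulVec_smul, add_dotProduct, dotProduct_add, smul_dotProduct,
    dotProduct_smul, smul_eq_mul, posDef_dotProduct_inv_comm hV (noiseSum x e t) (x t).ofLp]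
  have hw := posDef_dotProduct_inv_nonneg hV (x t).ofLp
  set w := (x t).ofLp ⬝ᵥ ((gram lam x t)⁻¹ *ᵥ (x t).ofLp)
  set s := (x t).ofLp ⬝ᵥ ((gram lam x t)⁻¹ *ᵥ noiseSum x e t)
  set Q := noiseSum x e t ⬝ᵥ ((gram lam x t)⁻¹ *ᵥ noiseSum x e t)
  have h1 : √(lam ^ d / ((gram lam x t).det * (1 + w))) =
      √(lam ^ d / (gram lam x t).det) * (√(1 + w))⁻¹ := by
    rw [← div_div, Real.sqrt_div' _ (by positivity), div_eq_mul_inv]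
  rw [h1, mul_mul_mul_comm, ← Real.exp_add]
  congr 2
  field_simp
  ring

variable {Ω : Type*} {mΩ : MeasurableSpace Ω} {μ : Measure Ω}

/-- The null set depends on l, so the bound is taken at rational l and passed to the limit by Fatou.
-/
lemma IsCondLaw.lintegral_exp_le {m : MeasurableSpace Ω} {mΩ : MeasurableSpace Ω}
    {μ : Measure Ω} {Z : Ω → ℝ} {κ : Ω → Measure ℝ} (hκ : IsCondLaw μ m Z κ) {ρ : ℝ}
    (h : ∀ l : ℝ, Integrable (fun ω => Real.exp (l * Z ω)) μ ∧
      μ[fun ω => Real.exp (l * Z ω) | m] ≤ᵐ[μ] fun _ => Real.exp (l ^ 2 * ρ ^ 2 / 2)) :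
    ∀ᵐ ω ∂μ, ∀ l : ℝ, ∫⁻ y, ENNReal.ofReal (Real.exp (l * y)) ∂κ ω ≤
      ENNReal.ofReal (Real.exp (l ^ 2 * ρ ^ 2 / 2)) := by
  have hrat : ∀ᵐ ω ∂μ, ∀ q : ℚ, ∫⁻ y, ENNReal.ofReal (Real.exp (q * y)) ∂κ ω ≤
      ENNReal.ofReal (Real.exp ((q : ℝ) ^ 2 * ρ ^ 2 / 2)) := by
    rw [ae_all_iff]
    intro q
    have hmeas : Measurable fun y : ℝ => Real.exp (q * y) := by fun_prop
    filter_upwards [(h q).2, hκ.condExp_eq _ hmeas (h q).1, hκ.integrable _ hmeas (h q).1]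
      with ω h1 h2 h3
    rw [← ofReal_integral_eq_lintegral_ofReal h3 (ae_of_all _ fun y => (Real.exp_pos _).le), ← h2]
    exact ENNReal.ofReal_le_ofReal h1
  filter_upwards [hrat] with ω hω l
  obtain ⟨q, hq⟩ : ∃ q : ℕ → ℚ, Filter.Tendsto (fun k => (q k : ℝ)) Filter.atTop (nhds l) := by
    obtain ⟨q, -, -, hq⟩ := Real.exists_seq_rat_strictMono_tendsto l
    exact ⟨q, hq⟩
  have h1 : ∀ y : ℝ, ENNReal.ofReal (Real.exp (l * y)) =
      Filter.liminf (fun k => ENNReal.ofReal (Real.exp (q k * y))) Filter.atTop := fun y => by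
    refine (Filter.Tendsto.liminf_eq ?_).symm
    exact ENNReal.tendsto_ofReal ((Real.continuous_exp.tendsto _).comp (hq.mul_const y))
  simp_rw [h1]
  refine (lintegral_liminf_le fun k => by fun_prop).trans ?_
  have h2 : Filter.Tendsto (fun k => ENNReal.ofReal (Real.exp ((q k : ℝ) ^ 2 * ρ ^ 2 / 2)))
      Filter.atTop (nhds (ENNReal.ofReal (Real.exp (l ^ 2 * ρ ^ 2 / 2)))) :=
    ENNReal.tendsto_ofReal ((Real.continuous_exp.tendsto _).comp
      (((hq.pow 2).mul_const _).div_const _))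
  rw [← h2.liminf_eq]
  exact Filter.liminf_le_liminf (Filter.Eventually.of_forall fun k => hω (q k))

/-- The maximal inequality for the self-normalized exponential process. -/
lemma measure_selfNormalized_ge_le [IsProbabilityMeasure μ] {T : ℕ} {m : ℕ → MeasurableSpace Ω}
    {x : ℕ → Ω → Act d} {e : ℕ → Ω → ℝ} {lam : ℝ} (hlam : 0 < lam)
    (hm : ∀ t ∈ Set.Icc 1 T, m t ≤ mΩ)
    (hx : ∀ s t, 1 ≤ s → s ≤ t → t ≤ T → Measurable[m t] (x s))
    (he : ∀ s t, 1 ≤ s → s < t → t ≤ T → Measurable[m t] (e s))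
    (hem : ∀ t ∈ Set.Icc 1 T, Measurable (e t))
    (hsub : ∀ t ∈ Set.Icc 1 T, ∀ l : ℝ, Integrable (fun ω => Real.exp (l * e t ω)) μ ∧
      μ[fun ω => Real.exp (l * e t ω) | m t] ≤ᵐ[μ] fun _ => Real.exp (l ^ 2 / 2)) (c : ℝ) :
    ENNReal.ofReal c * μ {ω | ∃ t ∈ Set.Icc 1 T,
      c ≤ selfNormalized lam (fun s => x s ω) (fun s => e s ω) t} ≤ 1 := by
  set M : ℕ → Ω → ENNReal := fun t ω =>
    ENNReal.ofReal (selfNormalized lam (fun s => x s ω) (fun s => e s ω) t) with hM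
  have hVm : ∀ s t, 1 ≤ s → s ≤ t → t ≤ T → ∀ i j, Measurable[m t] fun ω =>
      (gram lam (fun s => x s ω) s)⁻¹ i j := fun s t hs hst ht =>
    measurable_matrix_inv (measurable_gram lam fun r hr => by
      rw [Finset.mem_Ico] at hr
      exact hx r t hr.1 (by omega) ht)
  have hSm : ∀ s t, 1 ≤ s → s ≤ t → t ≤ T → ∀ j, Measurable[m t] fun ω =>
      noiseSum (fun s => x s ω) (fun s => e s ω) s j := fun s t hs hst ht =>
    measurable_noiseSum (fun r hr => hx r t (Finset.mem_Ico.1 hr).1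
      (by have := (Finset.mem_Ico.1 hr).2; omega) ht) fun r hr => he r t (Finset.mem_Ico.1 hr).1
      (by have := (Finset.mem_Ico.1 hr).2; omega) ht
  have hMm : ∀ s t, 1 ≤ s → s ≤ t → t ≤ T → Measurable[m t] (M s) := by
    intro s t hs hst ht
    have hdet : Measurable[m t] fun ω => (gram lam (fun s => x s ω) s).det :=
      measurable_matrix_det (measurable_gram lam fun r hr => by
        rw [Finset.mem_Ico] at hr
        exact hx r t hr.1 (by omega) ht)
    have hS := hSm s t hs hst ht
    have hQ := measurable_dotProduct hS (measurable_matrix_mulVec (hVm s t hs hst ht) hS)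
    exact ENNReal.measurable_ofReal.comp <|
      (Real.continuous_sqrt.measurable.comp (measurable_const.div hdet)).mul
        (Real.measurable_exp.comp (hQ.div_const 2))
  have hsuper : ∀ t, 1 ≤ t → t < T → ∀ B, MeasurableSet[m t] B →
      ∫⁻ ω in B, M (t + 1) ω ∂μ ≤ ∫⁻ ω in B, M t ω ∂μ := by
    intro t h1 htT B hB
    have ht : t ∈ Set.Icc 1 T := ⟨h1, htT.le⟩
    have hB' := hm t ht _ hB
    obtain ⟨κ, hκ⟩ := exists_isCondLaw (μ := μ) (hm t ht) (hem t ht)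
    have hle := hκ.lintegral_exp_le (ρ := 1) fun l => by simpa using hsub t ht l
    have hxm := fun j => measurable_coord (hx t t h1 le_rfl htT.le) j
    have hsm := measurable_dotProduct hxm
      (measurable_matrix_mulVec (hVm t t h1 le_rfl htT.le) (hSm t t h1 le_rfl htT.le))
    have hwm := measurable_dotProduct hxm
      (measurable_matrix_mulVec (hVm t t h1 le_rfl htT.le) hxm)
    set s : Ω → ℝ := fun ω => (x t ω).ofLp ⬝ᵥ ((gram lam (fun s => x s ω) t)⁻¹ *ᵥ
      noiseSum (fun s => x s ω) (fun s => e s ω) t)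
    set w : Ω → ℝ := fun ω => (x t ω).ofLp ⬝ᵥ ((gram lam (fun s => x s ω) t)⁻¹ *ᵥ (x t ω).ofLp)
    have hfst : @Measurable (Ω × ℝ) Ω ((m t).prod inferInstance) (m t) Prod.fst :=
      @measurable_fst Ω ℝ (m t) _
    have hsnd : @Measurable (Ω × ℝ) ℝ ((m t).prod inferInstance) _ Prod.snd :=
      @measurable_snd Ω ℝ (m t) _
    have hr : Measurable[(m t).prod inferInstance] fun p : Ω × ℝ =>
        ENNReal.ofReal (mixture (s p.1) (w p.1) p.2) :=
      ENNReal.measurable_ofReal.comp <| measurable_mixture.comp <|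
        (hsm.comp hfst).prodMk ((hwm.comp hfst).prodMk hsnd)
    -- The indicator of B is absorbed into the past-measurable weight.
    have key := hκ.lintegral_mul_le ((hMm t t h1 le_rfl htT.le).indicator hB) hr (by
      filter_upwards [hle] with ω hω
      have := hκ.prob ω
      exact lintegral_mixture_le_one (fun l => by simpa using hω l)
        (posDef_dotProduct_inv_nonneg (gram_posDef hlam _ t) _) _)
    rw [← lintegral_indicator hB', ← lintegral_indicator hB']
    refine le_trans (le_of_eq ?_) key
    refine lintegral_congr fun ω => ?_
    by_cases hω : ω ∈ B
    · rw [Set.indicator_of_mem hω, Set.indicator_of_mem hω, hM]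
      simp only
      rw [← ENNReal.ofReal_mul (selfNormalized_nonneg _ _ _ _), selfNormalized_succ hlam _ _ h1]
    · rw [Set.indicator_of_notMem hω, Set.indicator_of_notMem hω, zero_mul]
  have hfin := mul_measure_exists_le_le hm hMm hsuper (ENNReal.ofReal c)
  have h1 : ∫⁻ ω, M 1 ω ∂μ = 1 := by
    simp [hM, selfNormalized_one hlam]
  rw [h1] at hfin
  refine le_trans ?_ hfin
  gcongr 2
  rintro ω ⟨t, ht, h⟩
  exact ⟨t, ht, ENNReal.ofReal_le_ofReal h⟩

lemma noiseSum_div (x : ℕ → Act d) (e : ℕ → ℝ) (ρ : ℝ) (t : ℕ) :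
    noiseSum x (fun s => e s / ρ) t = ρ⁻¹ • noiseSum x e t := by
  rw [noiseSum, noiseSum, Finset.smul_sum]
  refine Finset.sum_congr rfl fun s _ => ?_
  rw [smul_smul, div_eq_inv_mul]

/-- Logarithms give Q < log (det V / lam ^ d) + 2 log (1/δ); d ≥ 2 lets 2 log (1/δ) be replaced by d
log (1/δ). -/
lemma lt_of_selfNormalized_lt {lam D δ : ℝ} (hlam : 0 < lam) (hd : 2 ≤ d)
    (hδ0 : 0 < δ) (hδ1 : δ ≤ 1) (x : ℕ → Act d) (e : ℕ → ℝ) {t : ℕ} (ht : 1 ≤ t)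
    (hx : ∀ s ∈ Finset.Ico 1 t, ‖x s‖ ≤ D / 2) (h : selfNormalized lam x e t < 1 / δ) :
    noiseSum x e t ⬝ᵥ ((gram lam x t)⁻¹ *ᵥ noiseSum x e t) ≤
      d * Real.log ((1 + ((t : ℝ) - 1) * D ^ 2 / lam) / δ) := by
  have hdet := (gram_posDef hlam x t).det_pos
  have hd2 : (2 : ℝ) ≤ d := by exact_mod_cast hd
  rw [selfNormalized] at h
  set Q := noiseSum x e t ⬝ᵥ ((gram lam x t)⁻¹ *ᵥ noiseSum x e t)
  have ht1 : (0 : ℝ) ≤ (t : ℝ) - 1 := by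
    have : (1 : ℝ) ≤ t := by exact_mod_cast ht
    linarith
  have hpos : 0 < 1 + ((t : ℝ) - 1) * D ^ 2 / lam := by positivity
  have h1 := Real.log_lt_log (by positivity) h
  rw [Real.log_mul (by positivity) (by positivity), Real.log_exp, Real.log_sqrt (by positivity),
    one_div, Real.log_inv, Real.log_div (by positivity) hdet.ne'] at h1
  have h2 : (gram lam x t).det ≤ (lam * (1 + ((t : ℝ) - 1) * D ^ 2 / lam)) ^ d := by
    refine (det_gram_le hlam x t (B := D ^ 2) fun s hs => ?_).trans_eq ?_
    · have := hx s hs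
      have := norm_nonneg (x s)
      nlinarith
    · congr 1
      rw [Nat.cast_sub ht]
      field_simp
      push_cast
      ring
  have h3 := Real.log_le_log hdet h2
  rw [mul_pow, Real.log_mul (by positivity) (by positivity), Real.log_pow (1 + _) d] at h3
  rw [Real.log_div hpos.ne' hδ0.ne']
  have h4 : Real.log δ ≤ 0 := Real.log_nonpos hδ0.le hδ1
  nlinarith

/-- The self-normalized confidence bound. -/
theorem measure_noiseSum_gt_le [IsProbabilityMeasure μ] {T : ℕ} {m : ℕ → MeasurableSpace Ω}
    {x : ℕ → Ω → Act d} {e : ℕ → Ω → ℝ} {lam D δ ρ : ℝ} (hlam : 0 < lam) (hd : 2 ≤ d)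
    (hδ0 : 0 < δ) (hδ1 : δ ≤ 1) (hρ : 0 ≤ ρ)
    (hm : ∀ t ∈ Set.Icc 1 T, m t ≤ mΩ)
    (hx : ∀ s t, 1 ≤ s → s ≤ t → t ≤ T → Measurable[m t] (x s))
    (he : ∀ s t, 1 ≤ s → s < t → t ≤ T → Measurable[m t] (e s))
    (hem : ∀ t ∈ Set.Icc 1 T, Measurable (e t))
    (hsub : ∀ t ∈ Set.Icc 1 T, CondSubgaussian μ (m t) (e t) ρ)
    (hxb : ∀ t ∈ Set.Icc 1 T, ∀ ω, ‖x t ω‖ ≤ D / 2) :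
    μ {ω | ¬ ∀ t ∈ Set.Icc 1 T, noiseSum (fun s => x s ω) (fun s => e s ω) t ⬝ᵥ
      ((gram lam (fun s => x s ω) t)⁻¹ *ᵥ noiseSum (fun s => x s ω) (fun s => e s ω) t) ≤
        ρ ^ 2 * (d * Real.log ((1 + ((t : ℝ) - 1) * D ^ 2 / lam) / δ))} ≤
      ENNReal.ofReal δ := by
  rcases hρ.eq_or_lt with rfl | hρ
  · have hz : ∀ᵐ ω ∂μ, ∀ t, t ∈ Set.Icc 1 T → e t ω = 0 := by
      rw [ae_all_iff]
      intro t
      by_cases ht : t ∈ Set.Icc 1 T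
      swap
      · exact ae_of_all _ fun ω h => absurd h ht
      have h := (hsub t ht).2.2
      have hint : ∀ l : ℝ, ∫ ω, Real.exp (l * e t ω) ∂μ ≤ 1 := fun l => by
        rw [← integral_condExp (hm t ht)]
        refine (integral_mono_ae integrable_condExp (integrable_const _) (h l).2).trans ?_
        simp
      have hI := ((h 1).1.add (h (-1)).1).sub (integrable_const 2)
      have hnn : ∀ ω, 0 ≤ Real.exp (1 * e t ω) + Real.exp (-1 * e t ω) - 2 := fun ω => by
        have h1 := Real.one_le_cosh (e t ω)
        rw [Real.cosh_eq] at h1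
        rw [one_mul, neg_one_mul]
        linarith
      have h0 : ∫ ω, (Real.exp (1 * e t ω) + Real.exp (-1 * e t ω) - 2) ∂μ = 0 := by
        refine le_antisymm ?_ (integral_nonneg hnn)
        have hadd : Integrable (fun ω => Real.exp (1 * e t ω) + Real.exp (-1 * e t ω)) μ :=
          (h 1).1.add (h (-1)).1
        rw [integral_sub hadd (integrable_const 2), integral_add (h 1).1 (h (-1)).1]
        have h1 := hint 1
        have h2 := hint (-1)
        simp only [integral_const, probReal_univ, one_smul]
        linarith
      rw [integral_eq_zero_iff_of_nonneg hnn hI] at h0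
      filter_upwards [h0] with ω hω _
      by_contra hne
      have h1 := Real.one_lt_cosh.2 hne
      rw [Real.cosh_eq] at h1
      simp only [Pi.zero_apply, one_mul, neg_one_mul] at hω
      linarith
    have hnull : μ {ω | ¬ ∀ t ∈ Set.Icc 1 T, noiseSum (fun s => x s ω) (fun s => e s ω) t ⬝ᵥ
      ((gram lam (fun s => x s ω) t)⁻¹ *ᵥ noiseSum (fun s => x s ω) (fun s => e s ω) t) ≤
        0 ^ 2 * (d * Real.log ((1 + ((t : ℝ) - 1) * D ^ 2 / lam) / δ))} = 0 := by
      change ∀ᵐ ω ∂μ, _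
      filter_upwards [hz] with ω hω t ht
      have : noiseSum (fun s => x s ω) (fun s => e s ω) t = 0 := by
        refine Finset.sum_eq_zero fun s hs => ?_
        rw [Finset.mem_Ico] at hs
        simp only [hω s ⟨hs.1, hs.2.le.trans ht.2⟩, zero_smul]
      rw [this]
      simp
    rw [hnull]
    exact zero_le
  · have key := measure_selfNormalized_ge_le (μ := μ) (T := T) (m := m) (x := x)
      (e := fun s ω => e s ω / ρ) hlam hm hx
      (fun s t h1 h2 h3 => (he s t h1 h2 h3).div_const ρ)
      (fun t ht => (hem t ht).div_const ρ)
      (fun t ht l => by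
        have h := (hsub t ht).2.2 (l / ρ)
        have h1 : ∀ ω, l / ρ * e t ω = l * (e t ω / ρ) := fun ω => by ring
        have h2 : (l / ρ) ^ 2 * ρ ^ 2 / 2 = l ^ 2 / 2 := by field_simp
        simp only [h1, h2] at h
        exact h) (1 / δ)
    have hc : ENNReal.ofReal (1 / δ) = (ENNReal.ofReal δ)⁻¹ := by
      rw [one_div, ENNReal.ofReal_inv_of_pos hδ0]
    rw [hc, ENNReal.inv_mul_le_iff (by simpa using hδ0) ENNReal.ofReal_ne_top, mul_one] at key
    refine le_trans (measure_mono fun ω hω => ?_) key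
    by_contra hcon
    refine hω fun t ht => ?_
    have hlt : selfNormalized lam (fun s => x s ω) (fun s => e s ω / ρ) t < 1 / δ :=
      not_le.1 fun h => hcon ⟨t, ht, h⟩
    have h := lt_of_selfNormalized_lt (D := D) hlam hd hδ0 hδ1 _ _ ht.1 (fun s hs => by
      rw [Finset.mem_Ico] at hs
      exact hxb s ⟨hs.1, hs.2.le.trans ht.2⟩ ω) hlt
    rw [noiseSum_div, mulVec_smul, smul_dotProduct, dotProduct_smul, smul_eq_mul, smul_eq_mul,
      ← mul_assoc, ← mul_inv, ← sq, inv_mul_le_iff₀ (by positivity)] at h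
    exact h

end SelfNormalized

/-! ### Measurability of the action sets and of the safe scaling -/

section SetMeasurability

variable {α : Type*} {mα : MeasurableSpace α} {n d : ℕ}

/-- For the random phase start, which takes finitely many values: the event is decomposed along
them. -/
lemma measurableSet_of_nat_le {p : α → ℕ} (hp : Measurable p) {k : ℕ} (hk : ∀ a, p a ≤ k)
    {P : ℕ → α → Prop} (hP : ∀ τ ≤ k, MeasurableSet {a | P τ a}) :
    MeasurableSet {a | P (p a) a} := by
  have : {a | P (p a) a} = ⋃ τ ∈ Set.Iic k, p ⁻¹' {τ} ∩ {a | P τ a} := by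
    ext a
    simp [hk a]
  rw [this]
  exact MeasurableSet.biUnion (Set.to_countable _) fun τ hτ =>
    (hp (MeasurableSet.singleton τ)).inter (hP τ hτ)

lemma phaseStart_le_succ (lam : ℝ) (x : ℕ → Act d) (t : ℕ) : phaseStart lam x t ≤ t + 1 := by
  rcases Nat.eq_zero_or_pos t with rfl | ht
  · exact le_rfl
  · exact (phaseStart_le lam x ht).trans (Nat.le_succ t)

lemma measurable_phaseStart {x : ℕ → α → Act d} (lam : ℝ) {t : ℕ}
    (hx : ∀ s ∈ Finset.Ico 1 t, Measurable (x s)) :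
    Measurable fun a => phaseStart lam (fun s => x s a) t := by
  induction t with
  | zero => exact measurable_const
  | succ t ih =>
    have ih' := ih fun s hs => hx s (Finset.Ico_subset_Ico_right (Nat.le_succ t) hs)
    have hdet : ∀ τ ≤ t + 1, Measurable fun a => (gram lam (fun s => x s a) τ).det := fun τ hτ =>
      measurable_matrix_det (measurable_gram lam fun s hs =>
        hx s (Finset.Ico_subset_Ico_right hτ hs))
    simp only [phaseStart]
    refine Measurable.ite ?_ ih' measurable_const
    exact measurableSet_of_nat_le ih' (fun a => phaseStart_le_succ lam _ t) fun τ hτ =>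
      measurableSet_le (hdet (t + 1) le_rfl) (measurable_const.mul (hdet τ hτ))

lemma measurable_cross {x : ℕ → α → Act d} {ε : ℕ → α → Fin n → ℝ}
    (A : Matrix (Fin n) (Fin d) ℝ) {t : ℕ} (hx : ∀ s ∈ Finset.Ico 1 t, Measurable (x s))
    (hε : ∀ s ∈ Finset.Ico 1 t, Measurable (ε s)) (i : Fin n) (j : Fin d) :
    Measurable fun a => cross (fun s => x s a) (feedback A (fun s => x s a) fun s => ε s a) t i j
    := by
  simp only [cross, Matrix.sum_apply, vecMulVec_apply, feedback, Pi.add_apply]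
  exact Finset.measurable_sum _ fun s hs => ((measurable_matrix_mulVec (W := fun _ => A)
    (fun _ _ => measurable_const) (measurable_coord (hx s hs)) i).add
      ((measurable_pi_apply i).comp (hε s hs))).mul (measurable_coord (hx s hs) j)

lemma measurable_wnorm {W : α → Matrix (Fin d) (Fin d) ℝ} {v : α → Act d}
    (hW : ∀ i j, Measurable fun a => W a i j) (hv : Measurable v) :
    Measurable fun a => wnorm (W a) (v a) :=
  Real.continuous_sqrt.measurable.comp (measurable_dotProduct (measurable_coord hv)
    (measurable_matrix_mulVec hW (measurable_coord hv)))

lemma measurableSet_mem_estSet {X : Set (Act d)} (hX : IsClosed X) (b : Fin n → ℝ) (κ c : ℝ)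
    {S : α → Matrix (Fin n) (Fin d) ℝ} {V : α → Matrix (Fin d) (Fin d) ℝ} {v : α → Act d}
    (hS : ∀ i j, Measurable fun a => S a i j) (hV : ∀ i j, Measurable fun a => V a i j)
    (hv : Measurable v) : MeasurableSet {a | v a ∈ estSet X b κ c (S a) (V a)} := by
  have hVi := measurable_matrix_inv hV
  have hSV : ∀ i j, Measurable fun a => (S a * (V a)⁻¹) i j := fun i j => by
    simp only [Matrix.mul_apply]
    exact Finset.measurable_sum _ fun k _ => (hS i k).mul (hVi k j)
  have : {a | v a ∈ estSet X b κ c (S a) (V a)} = v ⁻¹' X ∩ ⋂ i, {a |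
      ((S a * (V a)⁻¹) *ᵥ (v a).ofLp) i + c * wnorm (V a)⁻¹ (v a) ≤ b i - κ} := by
    ext a
    simp [estSet]
  rw [this]
  refine (hv hX.measurableSet).inter (MeasurableSet.iInter fun i => measurableSet_le ?_
    measurable_const)
  exact (measurable_matrix_mulVec hSV (measurable_coord hv) i).add
    (measurable_const.mul (measurable_wnorm hVi hv))

lemma measurableSet_mem_phase_estSet {X : Set (Act d)} (hX : IsClosed X) (b : Fin n → ℝ) (κ : ℝ)
    (A : Matrix (Fin n) (Fin d) ℝ) (lam : ℝ) (c : ℕ → ℝ) {x : ℕ → α → Act d}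
    {ε : ℕ → α → Fin n → ℝ} {t : ℕ} (ht : 1 ≤ t)
    (hx : ∀ s ∈ Finset.Ico 1 t, Measurable (x s))
    (hε : ∀ s ∈ Finset.Ico 1 t, Measurable (ε s)) {v : α → Act d} (hv : Measurable v) :
    MeasurableSet {a | v a ∈ estSet X b κ (c (phaseStart lam (fun s => x s a) t))
      (cross (fun s => x s a) (feedback A (fun s => x s a) fun s => ε s a)
        (phaseStart lam (fun s => x s a) t))
      (gram lam (fun s => x s a) (phaseStart lam (fun s => x s a) t))} := by
  refine measurableSet_of_nat_le (P := fun τ a => v a ∈ estSet X b κ (c τ)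
      (cross (fun s => x s a) (feedback A (fun s => x s a) fun s => ε s a) τ)
      (gram lam (fun s => x s a) τ)) (measurable_phaseStart lam hx)
    (fun a => phaseStart_le lam _ ht) fun τ hτ => ?_
  have hsub : Finset.Ico 1 τ ⊆ Finset.Ico 1 t := Finset.Ico_subset_Ico_right hτ
  exact measurableSet_mem_estSet hX b κ (c τ)
    (measurable_cross A (fun s hs => hx s (hsub hs)) fun s hs => hε s (hsub hs))
    (measurable_gram lam fun s hs => hx s (hsub hs)) hv

lemma measurable_safeScale {Y : α → Set (Act d)} {v : α → Act d}
    (hYc : ∀ a, IsClosed (Y a)) (hY0 : ∀ a, (0 : Act d) ∈ Y a)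
    (hYs : ∀ a (q r : ℝ), 0 ≤ q → q ≤ r → r • v a ∈ Y a → q • v a ∈ Y a)
    (hm : ∀ q : ℝ, MeasurableSet {a | q • v a ∈ Y a}) :
    Measurable fun a => safeScale (Y a) (v a) := by
  refine measurable_of_Ici fun q => ?_
  have hmem := fun a => safeScale_mem (hYc a) (hY0 a) (v a)
  by_cases hq0 : q ≤ 0
  · convert MeasurableSet.univ
    exact Set.eq_univ_of_forall fun a => hq0.trans (hmem a).1.1
  by_cases hq1 : 1 < q
  · convert MeasurableSet.empty
    exact Set.eq_empty_of_forall_notMem fun a ha => not_lt.2 (ha.trans (hmem a).1.2) hq1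
  push Not at hq0 hq1
  convert hm q using 1
  ext a
  -- Star-shapedness identifies the superlevel set of the scale at 0 < q ≤ 1 with the event that q v
  -- lies in Y.
  exact ⟨fun h => hYs a q _ hq0.le h (hmem a).2, fun h => le_safeScale ⟨hq0.le, hq1⟩ h⟩

/-- Costs that are observed to be measurable at each point of the action set agree there, up to
their value at `0`, with a bounded jointly measurable function. -/
lemma exists_measurable_cost {X : Set (Act d)} (hX : Convex ℝ X) (hXc : IsClosed X)
    (hX0 : (0 : Act d) ∈ X) {G c : ℝ} {f : α → Act d → ℝ}
    (hf : ∀ a, AdmissibleCost X G (f a)) (hmeas : ∀ u ∈ X, Measurable fun a => f a u)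
    (hc : 0 ≤ c) (hGc : ∀ u ∈ X, G * ‖u‖ ≤ c) :
    ∃ g : α × Act d → ℝ, Measurable g ∧ (∀ p, g p ∈ Set.Icc (-c) c) ∧
      ∀ a, ∀ v ∈ X, g (a, v) = f a v - f a 0 := by
  -- Nothing is known of the cost off X, so it is evaluated through a measurable retraction r onto X
  -- and then clipped to [-c, c]. On X it is continuous in the action and measurable in the
  -- parameter, hence jointly measurable.
  obtain ⟨r, hr, hrX⟩ := (MeasurableEmbedding.subtype_coe hXc.measurableSet).exists_measurable_extend
    (measurable_id (α := X)) fun _ => ⟨⟨0, hX0⟩⟩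
  have hu : Measurable (Function.uncurry fun (v : X) (a : α) => f a v - f a 0) := by
    refine measurable_uncurry_of_continuous_of_measurable (fun a => ?_) fun v =>
      (hmeas v v.2).sub (hmeas 0 hX0)
    refine Continuous.sub ?_ continuous_const
    refine (LipschitzWith.of_dist_le_mul (K := G.toNNReal) fun u v => ?_).continuous
    rw [Real.dist_eq, Subtype.dist_eq, dist_eq_norm]
    refine ((hf a).abs_sub_le hX u.2 v.2).trans ?_
    gcongr
    exact Real.le_coe_toNNReal G
  refine ⟨fun p => max (-c) (min c (f p.1 (r p.2) - f p.1 0)), ?_, fun p => ⟨le_max_left _ _, ?_⟩,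
    fun a v hv => ?_⟩
  · have : Measurable fun p : α × Act d => f p.1 (r p.2) - f p.1 0 :=
      hu.comp ((hr.comp measurable_snd).prodMk measurable_fst)
    exact measurable_const.max (measurable_const.min this)
  · exact max_le (by linarith) (min_le_left _ _)
  · have h1 : (r v : Act d) = v := by
      have := congrFun hrX ⟨v, hv⟩
      simp only [Function.comp_apply, id] at this
      rw [this]
    have h2 := (hf a).abs_sub_le hX hv hX0
    rw [sub_zero] at h2
    have h3 := abs_le.1 (h2.trans (hGc v hv))
    simp only [h1]
    rw [min_eq_right h3.2, max_eq_right h3.1]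

end SetMeasurability

/-! ### The Azuma–Hoeffding inequality for sampled costs -/

section Azuma

variable {Ω : Type*} {mΩ : MeasurableSpace Ω} {μ : Measure Ω} {E : Type*} [mE : MeasurableSpace E]

/-- Hoeffding's lemma on an interval of length 2c, with variance proxy c². -/
lemma lintegral_exp_sub_integral_le {κ : Measure E} [IsProbabilityMeasure κ] {h : E → ℝ}
    (hh : Measurable h) {c : ℝ} (hc : 0 ≤ c) (hb : ∀ y, h y ∈ Set.Icc (-c) c) (l : ℝ) :
    ∫⁻ y, ENNReal.ofReal (Real.exp (l * (h y - ∫ z, h z ∂κ) - l ^ 2 * c ^ 2 / 2)) ∂κ ≤ 1 := by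
  have hs := hasSubgaussianMGF_of_mem_Icc hh.aemeasurable (ae_of_all κ hb)
  have hint := hs.integrable_exp_mul l
  have hle := hs.mgf_le l
  have hcc : (((‖c - -c‖₊ / 2) ^ 2 : NNReal) : ℝ) = c ^ 2 := by
    push_cast
    rw [Real.norm_of_nonneg (by linarith)]
    ring
  rw [hcc, mgf] at hle
  have : ∀ y, ENNReal.ofReal (Real.exp (l * (h y - ∫ z, h z ∂κ) - l ^ 2 * c ^ 2 / 2)) =
      ENNReal.ofReal (Real.exp (-(l ^ 2 * c ^ 2 / 2))) *
        ENNReal.ofReal (Real.exp (l * (h y - ∫ z, h z ∂κ))) := fun y => by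
    rw [← ENNReal.ofReal_mul (Real.exp_pos _).le, ← Real.exp_add]
    congr 2
    ring
  simp_rw [this]
  rw [lintegral_const_mul _ (by fun_prop), ← ofReal_integral_eq_lintegral_ofReal hint
    (ae_of_all _ fun y => (Real.exp_pos _).le), ← ENNReal.ofReal_mul (Real.exp_pos _).le]
  refine ENNReal.ofReal_le_one.2 ?_
  calc Real.exp (-(l ^ 2 * c ^ 2 / 2)) * ∫ y, Real.exp (l * (h y - ∫ z, h z ∂κ)) ∂κ
      ≤ Real.exp (-(l ^ 2 * c ^ 2 / 2)) * Real.exp (c ^ 2 * l ^ 2 / 2) := by gcongr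
    _ = 1 := by
      rw [← Real.exp_add]
      simp only [Real.exp_eq_one_iff]
      ring

/-- The Azuma–Hoeffding inequality for the deviations of `g_t(Y_t)` from its conditional mean. -/
theorem measure_sum_sub_integral_gt_le [IsProbabilityMeasure μ] {ℱ : Filtration ℕ mΩ} {T : ℕ}
    (hT : 1 ≤ T) {Y : ℕ → Ω → E} {κ : ℕ → Ω → Measure E} {g : ℕ → Ω × E → ℝ} {c δ R : ℝ}
    (hc : 0 ≤ c) (hδ0 : 0 < δ) (hδ1 : δ < 1)
    (hY : ∀ t ∈ Set.Icc 1 T, Measurable[ℱ t] (Y t))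
    (hκ : ∀ t ∈ Set.Icc 1 T, IsCondLaw μ (ℱ (t - 1)) (Y t) (κ t))
    (hg : ∀ t ∈ Set.Icc 1 T, Measurable[(ℱ (t - 1)).prod mE] (g t))
    (hgb : ∀ t ∈ Set.Icc 1 T, ∀ p, g t p ∈ Set.Icc (-c) c)
    (hR : c * √(2 * T * Real.log (1 / δ)) ≤ R) :
    μ {ω | R < ∑ t ∈ Finset.Icc 1 T, (g t (ω, Y t ω) - ∫ y, g t (ω, y) ∂κ t ω)} ≤
      ENNReal.ofReal δ := by
  set Z : ℕ → Ω → ℝ := fun t ω => g t (ω, Y t ω) - ∫ y, g t (ω, y) ∂κ t ω with hZ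
  have hgy : ∀ t ∈ Set.Icc 1 T, ∀ ω, Measurable fun y => g t (ω, y) := fun t ht ω =>
    (hg t ht).comp (@measurable_prodMk_left Ω E (ℱ (t - 1)) mE ω)
  have hL : 0 < Real.log (1 / δ) := Real.log_pos (by rw [lt_div_iff₀ hδ0]; linarith)
  rcases hc.eq_or_lt with rfl | hc
  · have h0 : ∀ t ∈ Set.Icc 1 T, ∀ p, g t p = 0 := fun t ht p => by
      have := hgb t ht p
      rw [neg_zero] at this
      exact le_antisymm this.2 this.1
    have hempty : {ω | R < ∑ t ∈ Finset.Icc 1 T, Z t ω} = ∅ := by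
      refine Set.eq_empty_of_forall_notMem fun ω hω => ?_
      have hs : ∑ t ∈ Finset.Icc 1 T, Z t ω = 0 := Finset.sum_eq_zero fun t ht => by
        simp [hZ, h0 t (Finset.mem_Icc.1 ht)]
      have hω' : R < ∑ t ∈ Finset.Icc 1 T, Z t ω := hω
      rw [zero_mul] at hR
      linarith
    rw [hempty]
    simp
  have hZm : ∀ s t, s ∈ Set.Icc 1 T → s ≤ t → Measurable[ℱ t] (Z s) := by
    intro s t hs hst
    have hid : @Measurable Ω Ω (ℱ s) (ℱ (s - 1)) id := measurable_id'' (ℱ.mono (Nat.sub_le s 1))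
    have h2 : @Measurable Ω (Ω × E) (ℱ s) ((ℱ (s - 1)).prod mE) fun ω => (ω, Y s ω) :=
      hid.prodMk (hY s hs)
    have h3 : Measurable[ℱ s] (Z s) := ((hg s hs).comp h2).sub
      (((hκ s hs).measurable_integral _ (hg s hs)).mono (ℱ.mono (Nat.sub_le s 1)) le_rfl)
    exact h3.mono (ℱ.mono hst) le_rfl
  have hmgf : ∀ l : ℝ, ∀ k ≤ T, ∫⁻ ω, ENNReal.ofReal (Real.exp
      (l * ∑ t ∈ Finset.Ico 1 (k + 1), Z t ω - k * (l ^ 2 * c ^ 2 / 2))) ∂μ ≤ 1 := by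
    intro l k
    induction k with
    | zero => intro _; simp
    | succ k ih =>
      intro hk
      have ht : k + 1 ∈ Set.Icc 1 T := ⟨by omega, hk⟩
      have hW : Measurable[ℱ k] fun ω => ENNReal.ofReal (Real.exp
          (l * ∑ t ∈ Finset.Ico 1 (k + 1), Z t ω - k * (l ^ 2 * c ^ 2 / 2))) := by
        have hS : Measurable[ℱ k] fun ω => ∑ t ∈ Finset.Ico 1 (k + 1), Z t ω :=
          Finset.measurable_sum _ fun s hs => by
            rw [Finset.mem_Ico] at hs
            exact hZm s k ⟨hs.1, by omega⟩ (by omega)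
        exact ENNReal.measurable_ofReal.comp <| Real.measurable_exp.comp <|
          (hS.const_mul l).sub_const _
      have hmI : Measurable[ℱ k] fun ω => ∫ y, g (k + 1) (ω, y) ∂κ (k + 1) ω :=
        (hκ _ ht).measurable_integral _ (hg _ ht)
      have hgk : Measurable[(ℱ k).prod mE] (g (k + 1)) := hg _ ht
      have hr : Measurable[(ℱ k).prod mE] fun p : Ω × E => ENNReal.ofReal (Real.exp
          (l * (g (k + 1) p - ∫ y, g (k + 1) (p.1, y) ∂κ (k + 1) p.1) - l ^ 2 * c ^ 2 / 2)) :=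
        ENNReal.measurable_ofReal.comp <| Real.measurable_exp.comp <|
          ((hgk.sub (hmI.comp (@measurable_fst Ω E (ℱ k) mE))).const_mul l).sub_const _
      have key := (hκ _ ht).lintegral_mul_le hW hr (ae_of_all _ fun ω => by
        have := (hκ _ ht).prob ω
        exact lintegral_exp_sub_integral_le (hgy _ ht ω) hc.le (fun y => hgb _ ht _) l)
      refine le_trans (le_of_eq (lintegral_congr fun ω => ?_)) (key.trans (ih (by omega)))
      rw [← ENNReal.ofReal_mul (Real.exp_pos _).le, ← Real.exp_add,
        Finset.sum_Ico_succ_top (by omega)]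
      congr 2
      push_cast
      simp only [hZ]
      ring
  have hTpos : (0 : ℝ) < T := by exact_mod_cast hT
  set L := Real.log (1 / δ)
  -- The optimal Chernoff parameter: the variance term becomes L while l R ≥ 2L, leaving exp L = 1/δ
  -- for Markov's inequality.
  set l := √(2 * L / T) / c
  have hl : 0 < l := by positivity
  have hl2 : T * (l ^ 2 * c ^ 2 / 2) = L := by
    rw [div_pow, Real.sq_sqrt (by positivity)]
    field_simp
  have hlR : 2 * L ≤ l * R := by
    calc 2 * L = l * (c * √(2 * T * L)) := by
          have : √(2 * L / T) * √(2 * T * L) = 2 * L := by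
            rw [← Real.sqrt_mul (by positivity)]
            have : 2 * L / T * (2 * T * L) = (2 * L) ^ 2 := by field_simp
            rw [this, Real.sqrt_sq (by positivity)]
          have hlc : l * c = √(2 * L / T) := div_mul_cancel₀ _ hc.ne'
          rw [← mul_assoc, hlc, this]
      _ ≤ l * R := by gcongr
  have hIcc : Finset.Icc 1 T = Finset.Ico 1 (T + 1) := by ext; simp
  have hM : Measurable fun ω => ENNReal.ofReal (Real.exp
      (l * ∑ t ∈ Finset.Ico 1 (T + 1), Z t ω - T * (l ^ 2 * c ^ 2 / 2))) := by
    have hS : Measurable fun ω => ∑ t ∈ Finset.Ico 1 (T + 1), Z t ω :=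
      Finset.measurable_sum _ fun s hs => by
        rw [Finset.mem_Ico] at hs
        exact (hZm s T ⟨hs.1, by omega⟩ (by omega)).mono (ℱ.le T) le_rfl
    exact ENNReal.measurable_ofReal.comp <| Real.measurable_exp.comp <|
      (hS.const_mul l).sub_const _
  have hmarkov := (mul_meas_ge_le_lintegral hM (ENNReal.ofReal (1 / δ))).trans (hmgf l T le_rfl)
  rw [one_div, ENNReal.ofReal_inv_of_pos hδ0, ENNReal.inv_mul_le_iff (by simpa using hδ0)
    ENNReal.ofReal_ne_top, mul_one] at hmarkov
  refine le_trans (measure_mono fun ω hω => ?_) hmarkov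
  have hω' : R < ∑ t ∈ Finset.Icc 1 T, Z t ω := hω
  change (ENNReal.ofReal δ)⁻¹ ≤ ENNReal.ofReal _
  rw [← ENNReal.ofReal_inv_of_pos hδ0, ← one_div]
  refine ENNReal.ofReal_le_ofReal ?_
  rw [← Real.log_le_iff_le_exp (by positivity), hl2, ← hIcc]
  have := mul_le_mul_of_nonneg_left hω'.le hl.le
  change L ≤ _
  linarith

end Azuma

/-! ### The processes of a run -/

section Run

variable {Ω : Type*} {mΩ : MeasurableSpace Ω} {μ : Measure Ω} {ℱ : Filtration ℕ mΩ}
  {n d T : ℕ} {alg : OnlineAlgorithm d} {X : Set (Act d)} {A : Matrix (Fin n) (Fin d) ℝ}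
  {b : Fin n → ℝ} {lam G c : ℝ} {β : ℕ → ℝ} {xt x : ℕ → Ω → Act d} {f : ℕ → Ω → Act d → ℝ}
  {ε : ℕ → Ω → Fin n → ℝ}

/-- A run does not postulate measurability of x_t. It follows by strong induction, as the
pessimistic set depends only on earlier actions and noise. -/
lemma IsRun.measurable_play (hrun : IsRun μ ℱ alg X A b T lam 0 β xt x f ε)
    (hX : Convex ℝ X) (hXc : IsClosed X) (hX0 : (0 : Act d) ∈ X) (hb : ∀ i, 0 ≤ b i)
    {t : ℕ} (ht : t ∈ Set.Icc 1 T) : Measurable[ℱ t] (x t) := by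
  induction t using Nat.strong_induction_on with
  | _ t ih =>
    have hxs : ∀ s ∈ Finset.Ico 1 t, Measurable[ℱ t] (x s) := fun s hs => by
      rw [Finset.mem_Ico] at hs
      exact (ih s hs.2 ⟨hs.1, hs.2.le.trans ht.2⟩).mono (ℱ.mono hs.2.le) le_rfl
    have hεs : ∀ s ∈ Finset.Ico 1 t, Measurable[ℱ t] (ε s) := fun s hs => by
      rw [Finset.mem_Ico] at hs
      exact (hrun.meas_noise s ⟨hs.1, hs.2.le.trans ht.2⟩).mono (ℱ.mono hs.2.le) le_rfl
    have hxt := hrun.meas_sample t ht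
    have hscale : Measurable[ℱ t] fun ω => safeScale (pessSet X b lam 0 β (fun s => x s ω)
        (feedback A (fun s => x s ω) fun s => ε s ω) t) (xt t ω) :=
      measurable_safeScale (fun ω => isClosed_estSet hXc) (fun ω => zero_mem_estSet hX0 hb)
        (fun ω q r hq hqr h => estSet_smul hX hX0 hq hqr hb h)
        fun q => measurableSet_mem_phase_estSet hXc b 0 A lam β ht.1 hxs hεs (hxt.const_smul q)
    have : x t = fun ω => safeScale (pessSet X b lam 0 β (fun s => x s ω)
        (feedback A (fun s => x s ω) fun s => ε s ω) t) (xt t ω) • xt t ω :=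
      funext fun ω => hrun.play t ht ω
    rw [this]
    exact hscale.smul hxt

/-- Almost surely, the sampled action belongs to the optimistic set, and the conditional expected
cost is the expected cost under the distribution chosen by the subroutine. -/
lemma IsRun.ae_sample [IsProbabilityMeasure μ]
    (hrun : IsRun μ ℱ alg X A b T lam 0 β xt x f ε)
    (hX : Convex ℝ X) (hXc : IsClosed X) (hX0 : (0 : Act d) ∈ X) (hb : ∀ i, 0 ≤ b i)
    {t : ℕ} (ht : t ∈ Set.Icc 1 T) {κ : Ω → Measure (Act d)}
    (hκ : IsCondLaw μ (ℱ (t - 1)) (xt t) κ) {g : Ω × Act d → ℝ}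
    (hg : Measurable[(ℱ (t - 1)).prod inferInstance] g) (hgb : ∀ p, g p ∈ Set.Icc (-c) c)
    (hgf : ∀ ω, ∀ v ∈ X, g (ω, v) = f t ω v - f t ω 0) :
    ∀ᵐ ω ∂μ, xt t ω ∈ optSet X b lam 0 β (fun s => x s ω)
        (feedback A (fun s => x s ω) fun s => ε s ω) t ∧
      f t ω (xt t ω) - expCost alg X b lam β (fun s => xt s ω) (fun s => x s ω)
        (feedback A (fun s => x s ω) fun s => ε s ω) (fun s => f s ω) t =
        g (ω, xt t ω) - ∫ y, g (ω, y) ∂κ ω := by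
  set K : Ω → Set (Act d) := fun ω => optSet X b lam 0 β (fun s => x s ω)
    (feedback A (fun s => x s ω) fun s => ε s ω) t with hK
  set p : Ω → Measure (Act d) := fun ω => alg.dist (K ω)
    (t - phaseStart lam (fun s => x s ω) t)
    (fun i => f (phaseStart lam (fun s => x s ω) t + i) ω)
    (fun i => xt (phaseStart lam (fun s => x s ω) t + i) ω) with hp
  have hpprob : ∀ ω, IsProbabilityMeasure (p ω) := fun ω => alg.isProb _ _ _ _
  have hpK : ∀ ω, p ω (K ω)ᶜ = 0 := fun ω =>
    alg.carried _ _ _ _ ⟨0, zero_mem_estSet hX0 hb⟩ (isClosed_estSet hXc)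
  have hxt : Measurable (xt t) := (hrun.meas_sample t ht).mono (ℱ.le t) le_rfl
  have hpκ : ∀ᵐ ω ∂μ, p ω = κ ω :=
    hκ.ae_eq_of_condExp_indicator hxt hpprob fun B hB => hrun.sample_law t ht B hB
  have hfst : @Measurable (Ω × Act d) Ω ((ℱ (t - 1)).prod inferInstance) (ℱ (t - 1)) Prod.fst :=
    @measurable_fst Ω (Act d) (ℱ (t - 1)) _
  have hsnd : @Measurable (Ω × Act d) (Act d) ((ℱ (t - 1)).prod inferInstance) _ Prod.snd :=
    @measurable_snd Ω (Act d) (ℱ (t - 1)) _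
  have hmemK : MeasurableSet[(ℱ (t - 1)).prod inferInstance] {q : Ω × Act d | q.2 ∈ K q.1} := by
    have hxs : ∀ s ∈ Finset.Ico 1 t, Measurable[(ℱ (t - 1)).prod inferInstance]
        fun q : Ω × Act d => x s q.1 := fun s hs => by
      rw [Finset.mem_Ico] at hs
      exact ((hrun.measurable_play hX hXc hX0 hb ⟨hs.1, hs.2.le.trans ht.2⟩).mono
        (ℱ.mono (by omega)) le_rfl).comp hfst
    have hεs : ∀ s ∈ Finset.Ico 1 t, Measurable[(ℱ (t - 1)).prod inferInstance]
        fun q : Ω × Act d => ε s q.1 := fun s hs => by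
      rw [Finset.mem_Ico] at hs
      exact ((hrun.meas_noise s ⟨hs.1, hs.2.le.trans ht.2⟩).mono
        (ℱ.mono (by omega)) le_rfl).comp hfst
    exact measurableSet_mem_phase_estSet hXc b 0 A lam (fun τ => -β τ) ht.1 hxs hεs hsnd
  have hmem : ∀ᵐ ω ∂μ, xt t ω ∈ K ω := by
    set φ : Ω × Act d → ENNReal := {q : Ω × Act d | q.2 ∈ K q.1}ᶜ.indicator fun _ => 1
    have hφ : Measurable[(ℱ (t - 1)).prod inferInstance] φ :=
      measurable_const.indicator hmemK.compl
    have hz : ∫⁻ ω, φ (ω, xt t ω) ∂μ = 0 := by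
      -- Disintegrating along the conditional law reduces the probability of leaving K to the mass
      -- that the subroutine's law gives to its complement, which is 0.
      rw [hκ.lintegral_eq φ hφ, ← lintegral_zero (μ := μ)]
      refine lintegral_congr_ae ?_
      filter_upwards [hpκ] with ω hω
      rw [← hω, ← lintegral_zero (μ := p ω)]
      refine lintegral_congr_ae ?_
      have : ∀ᵐ y ∂p ω, y ∈ K ω := hpK ω
      filter_upwards [this] with y hy
      exact Set.indicator_of_notMem (a := (ω, y)) (Set.notMem_compl_iff.2 hy) _
    have hφm : Measurable fun ω => φ (ω, xt t ω) := by
      have hid : @Measurable Ω Ω mΩ (ℱ (t - 1)) id := measurable_id'' (ℱ.le _)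
      have h2 : @Measurable Ω (Ω × Act d) mΩ ((ℱ (t - 1)).prod inferInstance)
        fun ω => (ω, xt t ω) := hid.prodMk hxt
      exact hφ.comp h2
    rw [lintegral_eq_zero_iff hφm] at hz
    filter_upwards [hz] with ω hω
    by_contra hne
    have : φ (ω, xt t ω) = 1 := Set.indicator_of_mem (a := (ω, xt t ω)) (Set.mem_compl hne) _
    rw [Pi.zero_apply, this] at hω
    exact one_ne_zero hω
  filter_upwards [hmem, hpκ] with ω h1 h2
  refine ⟨h1, ?_⟩
  -- g is the cost minus its value at 0; this shift cancels between the sample and its mean.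
  have hexp : expCost alg X b lam β (fun s => xt s ω) (fun s => x s ω)
      (feedback A (fun s => x s ω) fun s => ε s ω) (fun s => f s ω) t =
      ∫ y, g (ω, y) ∂κ ω + f t ω 0 := by
    rw [← h2]
    have hgy : Measurable fun y => g (ω, y) :=
      hg.comp (@measurable_prodMk_left Ω (Act d) (ℱ (t - 1)) _ ω)
    have hgi : Integrable (fun y => g (ω, y)) (p ω) :=
      Integrable.of_mem_Icc (-c) c hgy.aemeasurable (ae_of_all _ fun y => hgb _)
    have hae : ∀ᵐ y ∂p ω, f t ω y = g (ω, y) + f t ω 0 := by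
      have : ∀ᵐ y ∂p ω, y ∈ K ω := hpK ω
      filter_upwards [this] with y hy
      rw [hgf ω y hy.1]
      ring
    change ∫ y, f t ω y ∂p ω = _
    rw [integral_congr_ae hae, integral_add hgi (integrable_const _)]
    simp
  rw [hexp, hgf ω _ h1.1]
  ring

end Run

/-! ### Sign and monotonicity of the confidence radius -/

section ConfRadius

variable {n d : ℕ} {ρ D S lam δ : ℝ}

lemma one_le_confRadius_arg (hn : 1 ≤ n) (hlam : 0 < lam) (hδ0 : 0 < δ) (hδ1 : δ ≤ 1)
    {t : ℕ} (ht : 1 ≤ t) : 1 ≤ (1 + ((t : ℝ) - 1) * D ^ 2 / lam) / (δ / n) := by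
  have hn' : (1 : ℝ) ≤ n := by exact_mod_cast hn
  have ht' : (1 : ℝ) ≤ t := by exact_mod_cast ht
  have h1 : 0 ≤ ((t : ℝ) - 1) * D ^ 2 / lam := by
    have : (0 : ℝ) ≤ (t : ℝ) - 1 := by linarith
    positivity
  have h2 : δ / n ≤ 1 := (div_le_one (by positivity)).2 (hδ1.trans hn')
  rw [le_div_iff₀ (by positivity)]
  linarith

lemma confRadius_nonneg (hρ : 0 ≤ ρ) (hS : 0 ≤ S) (t : ℕ) :
    0 ≤ confRadius n d ρ D S lam δ t := by
  unfold confRadius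
  positivity

lemma confRadius_mono (hn : 1 ≤ n) (hρ : 0 ≤ ρ) (hlam : 0 < lam) (hδ0 : 0 < δ) (hδ1 : δ ≤ 1)
    {s t : ℕ} (hs : 1 ≤ s) (hst : s ≤ t) :
    confRadius n d ρ D S lam δ s ≤ confRadius n d ρ D S lam δ t := by
  have h := one_le_confRadius_arg (D := D) hn hlam hδ0 hδ1 hs
  have hst' : (s : ℝ) ≤ t := by exact_mod_cast hst
  have hn' : (1 : ℝ) ≤ n := by exact_mod_cast hn
  unfold confRadius
  gcongr

end ConfRadius

end OSOCO

end

/-! ### The main theorem: union bound over the failure events -/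

open OSOCO in
theorem theorem1
    {Ω : Type*} {mΩ : MeasurableSpace Ω} (μ : Measure Ω) [IsProbabilityMeasure μ]
    (ℱ : Filtration ℕ mΩ)
    {n d : ℕ} (hn : 1 ≤ n) (hd : 2 ≤ d) {T : ℕ} (hT : 3 ≤ T)
    -- the action set
    (D : ℝ) (X : Set (OSOCO.Act d)) (hXconv : Convex ℝ X) (hXclosed : IsClosed X)
    (hXbdd : ∀ u ∈ X, ‖u‖ ≤ D / 2) (hX0 : (0 : OSOCO.Act d) ∈ X)
    -- the constraints
    (S : ℝ) (A : Matrix (Fin n) (Fin d) ℝ)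
    (hA : ∀ i, ‖(WithLp.toLp 2 (A i) : OSOCO.Act d)‖ ≤ S)
    (b : Fin n → ℝ) (hb : 0 < ⨅ i, b i)
    -- the subroutine
    (G : ℝ) (alg : OSOCO.OnlineAlgorithm d) (C : ℝ)
    (hC : OSOCO.HasRegretConstant alg D G T C)
    -- the parameters of OSOCO
    (ρ : ℝ) (hρ : 0 ≤ ρ) (δ : ℝ) (hδ : δ ∈ Set.Ioo (0 : ℝ) (1 / 2))
    (lam : ℝ) (hlam : lam = max 1 (D ^ 2))
    (β : ℕ → ℝ) (hβ : β = OSOCO.confRadius n d ρ D S lam δ)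
    -- the game
    (xt x : ℕ → Ω → OSOCO.Act d) (f : ℕ → Ω → OSOCO.Act d → ℝ) (ε : ℕ → Ω → Fin n → ℝ)
    (hrun : OSOCO.IsRun μ ℱ alg X A b T lam 0 β xt x f ε)
    (hf : ∀ t ∈ Set.Icc 1 T, ∀ ω, OSOCO.AdmissibleCost X G (f t ω))
    (hε : ∀ t ∈ Set.Icc 1 T, ∀ i,
      OSOCO.CondSubgaussian μ (OSOCO.noiseInfo x ε t) (fun ω => ε t ω i) ρ) :
    1 - 2 * δ ≤ μ.real {ω |
      OSOCO.regret X A b T (fun t => f t ω) (fun t => x t ω) ≤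
          4 * (D * G / ⨅ i, b i) * β T * √(3 * d * T * Real.log T)
            + C * √(4 * d * T * Real.log T)
            + 2 * D * G * √(2 * T * Real.log (1 / δ)) ∧
        ∀ t ∈ Set.Icc 1 T, A *ᵥ (x t ω).ofLp ≤ b} := by
  have hlam0 : 0 < lam := hlam ▸ lt_max_of_lt_left one_pos
  have hδ0 : 0 < δ := hδ.1
  have hδ1 : δ < 1 := hδ.2.trans (by norm_num)
  have hn' : (1 : ℝ) ≤ n := by exact_mod_cast hn
  have hbm : ∀ i, (⨅ i, b i) ≤ b i := fun i => ciInf_le (Set.finite_range b).bddBelow i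
  have hb0 : ∀ i, 0 ≤ b i := fun i => hb.le.trans (hbm i)
  have hS : 0 ≤ S := (norm_nonneg _).trans (hA ⟨0, hn⟩)
  have hD : 0 ≤ D := by
    have := hXbdd 0 hX0
    rw [norm_zero] at this
    linarith
  obtain ⟨ω₀⟩ := nonempty_of_isProbabilityMeasure μ
  have hG : 0 ≤ G := (hf 1 ⟨le_rfl, by omega⟩ ω₀).nonneg ⟨0, hX0⟩
  have hxm : ∀ t ∈ Set.Icc 1 T, Measurable (x t) := fun t ht =>
    (hrun.measurable_play hXconv hXclosed hX0 hb0 ht).mono (ℱ.le t) le_rfl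
  have hεm : ∀ t ∈ Set.Icc 1 T, Measurable (ε t) := fun t ht =>
    (hrun.meas_noise t ht).mono (ℱ.le t) le_rfl
  have hxb : ∀ t ∈ Set.Icc 1 T, ∀ ω, ‖x t ω‖ ≤ D / 2 := fun t ht ω =>
    hXbdd _ (mem_pessSet_of_play (x := fun s => x s ω) (xt := fun s => xt s ω)
      hXclosed hX0 hb0 (hrun.play t ht ω)).1
  -- the confidence sets are valid with high probability
  set bad : Fin n → Set Ω := fun i => {ω | ¬ ∀ t ∈ Set.Icc 1 T,
      noiseSum (fun s => x s ω) (fun s => ε s ω i) t ⬝ᵥ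
      ((OSOCO.gram lam (fun s => x s ω) t)⁻¹ *ᵥ noiseSum (fun s => x s ω) (fun s => ε s ω i) t) ≤
        ρ ^ 2 * (d * Real.log ((1 + ((t : ℝ) - 1) * D ^ 2 / lam) / (δ / n)))}
  have hconf : ∀ i, μ (bad i) ≤
      ENNReal.ofReal (δ / n) := by
    intro i
    refine measure_noiseSum_gt_le (m := noiseInfo x ε) (x := x) (e := fun s ω => ε s ω i) hlam0 hd
      (by positivity) ((div_le_one (by positivity)).2 (hδ1.le.trans hn')) hρ (fun t ht => ?_)
      (fun s t hs hst ht => ?_) (fun s t hs hst ht => ?_)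
      (fun t ht => (measurable_pi_apply i).comp (hεm t ht)) (fun t ht => hε t ht i) hxb
    · exact sup_le (iSup₂_le fun s hs => (hxm s ⟨hs.1, hs.2.trans ht.2⟩).comap_le)
        (iSup₂_le fun s hs => (hεm s ⟨hs.1, hs.2.le.trans ht.2⟩).comap_le)
    · exact (comap_measurable (x s)).mono (le_sup_of_le_left
        (le_iSup₂_of_le s ⟨hs, hst⟩ le_rfl)) le_rfl
    · exact (measurable_pi_apply i).comp ((comap_measurable (ε s)).mono (le_sup_of_le_right
        (le_iSup₂_of_le s ⟨hs, hst⟩ le_rfl)) le_rfl)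
  -- the sampled costs are close to the expected costs with high probability
  have hκ : ∀ t, ∃ κ : Ω → Measure (Act d), t ∈ Set.Icc 1 T →
      IsCondLaw μ (ℱ (t - 1)) (xt t) κ := fun t => by
    by_cases ht : t ∈ Set.Icc 1 T
    · obtain ⟨κ, h⟩ := exists_isCondLaw (μ := μ) (ℱ.le (t - 1))
        ((hrun.meas_sample t ht).mono (ℱ.le t) le_rfl)
      exact ⟨κ, fun _ => h⟩
    · exact ⟨fun _ => 0, fun h => absurd h ht⟩
  choose κ hκ using hκ
  have hg : ∀ t, ∃ g : Ω × Act d → ℝ, t ∈ Set.Icc 1 T →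
      Measurable[(ℱ (t - 1)).prod inferInstance] g ∧
      (∀ p, g p ∈ Set.Icc (-(G * (D / 2))) (G * (D / 2))) ∧
      ∀ ω, ∀ v ∈ X, g (ω, v) = f t ω v - f t ω 0 := fun t => by
    by_cases ht : t ∈ Set.Icc 1 T
    · obtain ⟨g, h⟩ := exists_measurable_cost (mα := ℱ (t - 1)) hXconv hXclosed hX0 (hf t ht)
        (hrun.meas_cost t ht) (by positivity : 0 ≤ G * (D / 2))
        fun u hu => mul_le_mul_of_nonneg_left (hXbdd u hu) hG
      exact ⟨g, fun _ => h⟩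
    · exact ⟨fun _ => 0, fun h => absurd h ht⟩
  choose g hg using hg
  -- Costs shifted to vanish at 0 lie within ±GD/2 on X, so a quarter of the stated deviation would
  -- suffice.
  have hazuma := measure_sum_sub_integral_gt_le (μ := μ) (ℱ := ℱ) (Y := xt) (κ := κ) (g := g)
    (T := T) (by omega) (by positivity : 0 ≤ G * (D / 2)) hδ0 hδ1 hrun.meas_sample hκ
    (fun t ht => (hg t ht).1) (fun t ht => (hg t ht).2.1)
    (R := 2 * D * G * √(2 * T * Real.log (1 / δ))) (by
      refine mul_le_mul_of_nonneg_right ?_ (Real.sqrt_nonneg _)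
      nlinarith [mul_nonneg hD hG])
  have hsample : ∀ᵐ ω ∂μ, ∀ t, t ∈ Set.Icc 1 T →
      xt t ω ∈ optSet X b lam 0 β (fun s => x s ω)
        (feedback A (fun s => x s ω) fun s => ε s ω) t ∧
      f t ω (xt t ω) - expCost alg X b lam β (fun s => xt s ω) (fun s => x s ω)
        (feedback A (fun s => x s ω) fun s => ε s ω) (fun s => f s ω) t =
        g t (ω, xt t ω) - ∫ y, g t (ω, y) ∂κ t ω := by
    rw [ae_all_iff]
    intro t
    by_cases ht : t ∈ Set.Icc 1 T
    · filter_upwards [hrun.ae_sample hXconv hXclosed hX0 hb0 ht (hκ t ht) (hg t ht).1 (hg t ht).2.1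
        (hg t ht).2.2] with ω hω _ using hω
    · exact ae_of_all _ fun ω h => absurd h ht
  set good := {ω | regret X A b T (fun t => f t ω) (fun t => x t ω) ≤
          4 * (D * G / ⨅ i, b i) * β T * √(3 * d * T * Real.log T)
            + C * √(4 * d * T * Real.log T)
            + 2 * D * G * √(2 * T * Real.log (1 / δ)) ∧
        ∀ t ∈ Set.Icc 1 T, A *ᵥ (x t ω).ofLp ≤ b}
  -- Only an almost sure inclusion, because samples lie in the optimistic sets only almost surely.
  have hsub : goodᶜ ≤ᵐ[μ] ((⋃ i, bad i) ∪
      {ω | 2 * D * G * √(2 * T * Real.log (1 / δ)) <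
        ∑ t ∈ Finset.Icc 1 T, (g t (ω, xt t ω) - ∫ y, g t (ω, y) ∂κ t ω)} : Set Ω) := by
    filter_upwards [hsample] with ω hω hbad
    by_contra hnot
    refine hbad ?_
    have hnoise : ∀ i, ∀ t ∈ Set.Icc 1 T,
      noiseSum (fun s => x s ω) (fun s => ε s ω i) t ⬝ᵥ
      ((OSOCO.gram lam (fun s => x s ω) t)⁻¹ *ᵥ noiseSum (fun s => x s ω) (fun s => ε s ω i) t) ≤
        ρ ^ 2 * (d * Real.log ((1 + ((t : ℝ) - 1) * D ^ 2 / lam) / (δ / n))) := fun i => by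
      by_contra h
      exact hnot (Or.inl (Set.mem_iUnion.2 ⟨i, h⟩))
    have hsum : ∑ t ∈ Finset.Icc 1 T, (g t (ω, xt t ω) - ∫ y, g t (ω, y) ∂κ t ω) ≤
        2 * D * G * √(2 * T * Real.log (1 / δ)) := not_lt.1 fun h => hnot (Or.inr h)
    refine regret_le_and_safe (xt := fun t => xt t ω) (x := fun t => x t ω)
      (y := feedback A (fun s => x s ω) fun s => ε s ω) (f := fun t => f t ω) hC hb hbm hd hT
      hXconv hXclosed hXbdd hX0 hlam (β := β)
      (fun t _ => hβ ▸ confRadius_nonneg hρ hS t)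
      (fun t ht => hβ ▸ confRadius_mono hn hρ hlam0 hδ0 hδ1.le ht.1 ht.2)
      (fun t ht => hf t ht ω) (fun t ht => hrun.play t ht ω) (fun t ht => (hω t ht).1)
      (fun t ht u i => ?_) ?_
    · rw [hβ]
      have hlog := Real.log_nonneg (one_le_confRadius_arg (D := D) hn hlam0 hδ0 hδ1.le ht.1)
      refine abs_estimate_sub_le hlam0 A _ _ ht.1 u i (hA i) (by positivity) ?_
      rw [mul_pow, Real.sq_sqrt (by positivity)]
      exact hnoise i t ht
    · refine (Finset.sum_congr rfl fun t ht => ?_).trans_le hsum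
      exact (hω t (Finset.mem_Icc.1 ht)).2
  have hbad : μ goodᶜ ≤ ENNReal.ofReal (2 * δ) := by
    refine (measure_mono_ae hsub).trans ((measure_union_le _ _).trans ?_)
    rw [two_mul δ, ENNReal.ofReal_add hδ0.le hδ0.le]
    refine add_le_add ((measure_iUnion_le _).trans ?_) hazuma
    rw [tsum_fintype]
    refine (Finset.sum_le_sum fun i _ => hconf i).trans_eq ?_
    rw [Finset.sum_const, Finset.card_univ, Fintype.card_fin, nsmul_eq_mul,
      ← ENNReal.ofReal_natCast, ← ENNReal.ofReal_mul (by positivity)]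
    congr 1
    field_simp
  -- Subadditivity suffices here, so measurability of the good event is not required.
  have hone : 1 ≤ μ good + μ goodᶜ := by
    rw [← measure_univ (μ := μ), ← Set.union_compl_self good]
    exact measure_union_le _ _
  have hle : ENNReal.ofReal 1 ≤ ENNReal.ofReal (μ.real good + 2 * δ) := by
    rw [ENNReal.ofReal_one, ENNReal.ofReal_add measureReal_nonneg (by linarith),
      ofReal_measureReal]
    exact hone.trans (by gcongr)
  have hpos : 0 ≤ μ.real good := measureReal_nonneg
  linarith [(ENNReal.ofReal_le_ofReal_iff (by linarith)).1 hle]
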